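/- Let $\mathbb{H}$ be the algebra of quaternions and let $\mathbb{S}=\{q\in\mathbb{H} : q^2=-1\}$ be the set of its imaginary units. Let $\mathsf{H}\neq\{0\}$ be a quaternionic right Hilbert space: a right $\mathbb{H}$-module with an $\mathbb{H}$-valued Hermitian scalar product $\langle u|v\rangle$, right linear in $v$, with $\langle u|v\rangle=\overline{\langle v|u\rangle}$ and $\langle u|u\rangle=\|u\|^2\ge 0$, complete in the norm $\|\cdot\|$. Let $\mathfrak{B}(\mathsf{H})$ be the set of continuous right $\mathbb{H}$-linear operators on $\mathsf{H}$, with the operator norm and with the adjoint given by $\langle T^*u|v\rangle=\langle u|Tv\rangle$; $T$ is normal if $TT^*=T^*T$, and $T\ge 0$ means that $\langle u|Tu\rangle$ is a non-negative real number for every $u\in\mathsf{H}$. A left scalar multiplication of $\mathsf{H}$ is a map $\mathcal{L}:\mathbb{H}\to\mathfrak{B}(\mathsf{H})$, $q\mapsto L_q$, of the form $L_qu=\sum_{z\in N}zq\langle z|u\rangle$ for some Hilbert basis $N$ of $\mathsf{H}$ (an orthonormal set with $N^\perp=\{0\}$). Fix $\imath\in\mathbb{S}$ and put $\mathbb{C}_\imath^+=\{\alpha+\imath\beta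 : \alpha,\beta\in\mathbb{R},\ \beta\ge 0\}$, with its Borel $\sigma$-algebra $\mathscr{B}(\mathbb{C}_\imath^+)$. A qPVM over $\mathbb{C}_\imath^+$ in $\mathsf{H}$ is a map $P:\mathscr{B}(\mathbb{C}_\imath^+)\to\mathfrak{B}(\mathsf{H})$ with $P(\mathbb{C}_\imath^+)=\mathrm{I}$, $P(E)P(E')=P(E\cap E')$, $P(E)\ge 0$, and $\sum_{n}P(E_n)u=P(\bigcup_nE_n)u$ for every $u\in\mathsf{H}$ and every countable family of pairwise disjoint Borel sets $E_n$. Its support $\Gamma$ is the complement of the union of all open sets $O\subset\mathbb{C}_\imath^+$ with $P(O)=0$. An iqPVM is a pair $(P,\mathcal{L})$ of a qPVM $P$ and a left scalar multiplication $\mathcal{L}$ with $P(E)L_q=L_qP(E)$ for all $E\in\mathscr{B}(\mathbb{C}_\imath^+)$ and $q\in\mathbb{H}$; it is bounded if $\Gamma$ is bounded. For a simple function $s=\sum_\ell S_\ell\chi_{E_\ell}$ (finitely many $S_\ell\in\mathbb{H}$, and $E_\ell$ pairwise disjoint Borel sets) one puts $\int s\,d(P,\mathcal{L})=\sum_\ell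 L_{S_\ell}P(E_\ell)$. For a function $\varphi:\mathbb{C}_\imath^+\to\mathbb{H}$ that is bounded and Borel measurable on $\Gamma$, $\int_{\mathbb{C}_\imath^+}\varphi\,d(P,\mathcal{L})$ is the limit in operator norm of $\int s_n\,d(P,\mathcal{L})$ for any simple functions $s_n$ that converge uniformly on $\mathbb{C}_\imath^+$ to the function equal to $\varphi$ on $\Gamma$ and to $0$ off $\Gamma$. Let $\mathrm{id}:\mathbb{C}_\imath^+\to\mathbb{H}$ be the inclusion. Let $T\in\mathfrak{B}(\mathsf{H})$ be normal, and let $P$ be the qPVM over $\mathbb{C}_\imath^+$ in $\mathsf{H}$ associated with $T$ by the spectral theorem, i.e. the qPVM with bounded support such that $(P,\mathcal{L}^0)$ is an iqPVM with $T=\int_{\mathbb{C}_\imath^+}\mathrm{id}\,d(P,\mathcal{L}^0)$ for some left scalar multiplication $\mathcal{L}^0$ of $\mathsf{H}$. Let $\mathcal{L}:q\mapsto L_q$ be a left scalar multiplication of $\mathsf{H}$. Then $(P,\mathcal{L})$ is an iqPVM over $\mathbb{C}_\imath^+$ in $\mathsf{H}$ with $T=\int_{\mathbb{C}_\imath^+}\mathrm{id}\,d(P,\mathcal{L})$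 if and only if the following three conditions hold: (i) $L_\imath T=TL_\imath$; (ii) $L_\jmath T=T^*L_\jmath$ for some $\jmath\in\mathbb{S}$ with $\imath\jmath=-\jmath\,\imath$; (iii) $-L_\imath(T-T^*)\ge 0$. -/

import Mathlib

open scoped Quaternion RightActions

noncomputable section

namespace QuaternionicSpectral

/-- A quaternionic (right) Hilbert space.  The right scalar multiplication `u q` is the action of
`MulOpposite.op q`, written `u <• q`; the Hermitian quaternionic scalar product `⟨u|v⟩` is
`inner ℍ u v`, it is right linear in the second variable and induces the norm; the space is
complete. -/
class QuaternionicHilbertSpace (H : Type*) [NormedAddCommGroup H] extends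
    Module ℍᵐᵒᵖ H, Inner ℍ H, CompleteSpace H where
  qinner_add_right : ∀ u v w : H, inner u (v + w) = inner u v + inner u w
  qinner_smul_right : ∀ (u v : H) (q : ℍ), inner u (v <• q) = inner u v * q
  qinner_conj_symm : ∀ u v : H, star (inner v u) = inner u v
  qinner_self : ∀ u : H, inner u u = ((‖u‖ ^ 2 : ℝ) : ℍ)

/-- `𝔅(H)`: the continuous right `ℍ`-linear operators on `H`, with composition as product. -/
abbrev BoundedOp (H : Type*) [NormedAddCommGroup H] [QuaternionicHilbertSpace H] : Type _ :=
  H →L[ℍᵐᵒᵖ] H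

section Adjoint

open QuaternionicHilbertSpace

/-- The real vector space underlying a quaternionic Hilbert space: `r u = u r`. -/
abbrev realModule (H : Type*) [NormedAddCommGroup H] [QuaternionicHilbertSpace H] : Module ℝ H :=
  Module.compHom H (algebraMap ℝ ℍᵐᵒᵖ)

variable {H : Type*} [NormedAddCommGroup H] [QuaternionicHilbertSpace H]

theorem qinner_add_left (u v w : H) : inner ℍ (u + v) w = inner ℍ u w + inner ℍ v w := by
  rw [← qinner_conj_symm (u + v) w, ← qinner_conj_symm u w, ← qinner_conj_symm v w,
    qinner_add_right, star_add]

theorem qinner_smul_left (u v : H) (q : ℍ) : inner ℍ (u <• q) v = star q * inner ℍ u v := by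
  rw [← qinner_conj_symm (u <• q) v, ← qinner_conj_symm u v, qinner_smul_right, star_mul]

theorem norm_smul_right (u : H) (q : ℍ) : ‖u <• q‖ = ‖q‖ * ‖u‖ := by
  have h := qinner_self (u <• q)
  rw [qinner_smul_right, qinner_smul_left, qinner_self, mul_assoc, Quaternion.coe_commutes,
    ← mul_assoc, Quaternion.star_mul_self, ← Quaternion.coe_mul, Quaternion.coe_inj,
    Quaternion.normSq_eq_norm_mul_self] at h
  rw [← sq_eq_sq₀ (norm_nonneg _) (by positivity), ← h]
  ring

/-- The real Hilbert space underlying a quaternionic Hilbert space, with scalar product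
`Re ⟨u|v⟩`. -/
abbrev realInnerProductSpace (H : Type*) [NormedAddCommGroup H] [QuaternionicHilbertSpace H] :
    InnerProductSpace ℝ H :=
  letI := realModule H
  have hs : ∀ (r : ℝ) (x : H), r • x = x <• (r : ℍ) := fun _ _ => rfl
  { toModule := realModule H
    norm_smul_le := fun r x => by rw [hs, norm_smul_right, Quaternion.norm_coe]
    inner := fun x y => (inner ℍ x y).re
    norm_sq_eq_re_inner := fun x => by
      rw [qinner_self, Quaternion.re_coe]; rfl
    conj_inner_symm := fun x y => by
      rw [conj_trivial, ← qinner_conj_symm x y, Quaternion.re_star]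
    add_left := fun x y z => by rw [qinner_add_left, Quaternion.re_add]
    smul_left := fun x y r => by
      rw [hs, qinner_smul_left, conj_trivial, Quaternion.star_coe, Quaternion.coe_mul_eq_smul,
        Quaternion.re_smul, smul_eq_mul] }

theorem eq_of_re_mul_eq {a b : ℍ} (h : ∀ q : ℍ, (a * q).re = (b * q).re) : a = b := by
  have h0 := h (star (a - b))
  rw [← sub_eq_zero, ← Quaternion.re_sub, ← sub_mul, Quaternion.self_mul_star,
    Quaternion.re_coe, Quaternion.normSq_eq_zero] at h0
  exact sub_eq_zero.1 h0

theorem eq_of_inner_eq {u v : H} (h : ∀ w : H, inner ℍ u w = inner ℍ v w) : u = v := by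
  have h0 : inner ℍ (u - v) (u - v) = 0 := by
    have := qinner_add_left (u - v) v (u - v)
    rw [sub_add_cancel, h, right_eq_add] at this
    exact this
  rw [qinner_self, ← Quaternion.coe_zero, Quaternion.coe_inj] at h0
  exact sub_eq_zero.1 (norm_eq_zero.1 (pow_eq_zero_iff two_ne_zero |>.1 h0))

theorem exists_adjoint (T : BoundedOp H) :
    ∃ S : BoundedOp H, ∀ u v : H, inner ℍ (S u) v = inner ℍ u (T v) := by
  let _ := realInnerProductSpace H
  let T' : H →L[ℝ] H :=
    { toFun := T
      map_add' := map_add T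
      map_smul' := fun r x => T.map_smul _ x
      cont := T.continuous }
  have hre : ∀ u v : H, (inner ℍ (T'.adjoint u) v).re = (inner ℍ u (T v)).re := fun u v =>
    ContinuousLinearMap.adjoint_inner_left T' v u
  have hq : ∀ u v : H, inner ℍ (T'.adjoint u) v = inner ℍ u (T v) := fun u v => by
    refine eq_of_re_mul_eq fun q => ?_
    rw [← qinner_smul_right, hre, map_smul, qinner_smul_right]
  refine ⟨{ toFun := T'.adjoint, map_add' := map_add _, map_smul' := fun q u => ?_,
            cont := T'.adjoint.continuous }, hq⟩
  refine eq_of_inner_eq fun w => ?_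
  obtain ⟨q, rfl⟩ := MulOpposite.op_surjective q
  rw [hq, RingHom.id_apply, qinner_smul_left, qinner_smul_left, hq]

/-- The adjoint `T*` of `T ∈ 𝔅(H)`. -/
def adjoint (T : BoundedOp H) : BoundedOp H := (exists_adjoint T).choose

theorem adjoint_inner_left (T : BoundedOp H) (u v : H) :
    inner ℍ (adjoint T u) v = inner ℍ u (T v) := (exists_adjoint T).choose_spec u v

/-- `T` is normal. -/
def IsNormal (T : BoundedOp H) : Prop := T * adjoint T = adjoint T * T

/-- `T ≥ 0`: the quaternion `⟨u|Tu⟩` is a non-negative real for every `u`. -/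
def IsPositive (T : BoundedOp H) : Prop :=
  ∀ u : H, ∃ r : ℝ, 0 ≤ r ∧ inner ℍ u (T u) = (r : ℍ)

end Adjoint

/-- The set `𝕊` of imaginary units of `ℍ`. -/
def imaginaryUnits : Set ℍ := {q | q * q = -1}

/-- The closed half plane `ℂ_ι⁺ = {α + ιβ : α, β ∈ ℝ, β ≥ 0}`. -/
def halfPlane (ι : ℍ) : Set ℍ := {q | ∃ α β : ℝ, 0 ≤ β ∧ q = (α : ℍ) + ι * (β : ℍ)}

/-- `ℂ_ι⁺` carries the Borel `σ`-algebra of the topology induced by `ℍ`. -/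
instance halfPlane.measurableSpace (ι : ℍ) : MeasurableSpace (halfPlane ι) := borel _

instance halfPlane.borelSpace (ι : ℍ) : BorelSpace (halfPlane ι) := ⟨rfl⟩

variable {H : Type*} [NormedAddCommGroup H] [QuaternionicHilbertSpace H]

/-- `N` is a Hilbert basis of `H`. -/
structure IsHilbertBasis (N : Set H) : Prop where
  norm_eq_one : ∀ z ∈ N, ‖z‖ = 1
  orthogonal : ∀ z ∈ N, ∀ z' ∈ N, z ≠ z' → inner ℍ z z' = 0
  perp_eq_zero : ∀ u : H, (∀ z ∈ N, inner ℍ u z = 0) → u = 0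

/-- `L : ℍ → 𝔅(H)` is a left scalar multiplication of `H`: it is induced by some Hilbert basis `N`,
`L_q u = ∑_{z ∈ N} z q ⟨z|u⟩`. -/
def IsLeftScalarMul (L : ℍ → BoundedOp H) : Prop :=
  ∃ N : Set H, IsHilbertBasis N ∧
    ∀ (q : ℍ) (u : H), HasSum (fun z : N => ((z : H) <• q) <• inner ℍ (z : H) u) (L q u)

section PVM

variable {ι : ℍ}

/-- `P` is a quaternionic projection-valued measure (qPVM) over `ℂ_ι⁺` in `H`.  Only the values of
`P` at Borel sets matter, here and in all that follows. -/
structure IsQPVM (P : Set (halfPlane ι) → BoundedOp H) : Prop where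
  univ : P Set.univ = 1
  inter : ∀ E E', MeasurableSet E → MeasurableSet E' → P E * P E' = P (E ∩ E')
  sigma_additive : ∀ (N : Set ℕ) (E : N → Set (halfPlane ι)), (∀ n, MeasurableSet (E n)) →
    Pairwise (fun n m => Disjoint (E n) (E m)) →
    ∀ u : H, HasSum (fun n => P (E n) u) (P (⋃ n, E n) u)
  positive : ∀ E, MeasurableSet E → IsPositive (P E)

/-- The support of `P`. -/
def pvmSupport (P : Set (halfPlane ι) → BoundedOp H) : Set (halfPlane ι) :=
  (⋃₀ {O | IsOpen O ∧ P O = 0})ᶜ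

/-- The pair `(P, L)` is an intertwining quaternionic projection-valued measure (iqPVM) over
`ℂ_ι⁺` in `H`. -/
structure IsIQPVM (P : Set (halfPlane ι) → BoundedOp H) (L : ℍ → BoundedOp H) : Prop where
  isQPVM : IsQPVM P
  isLeftScalarMul : IsLeftScalarMul L
  commute : ∀ (E : Set (halfPlane ι)) (q : ℍ), MeasurableSet E → P E * L q = L q * P E

/-- The integral `∑_ℓ L_{S_ℓ} P(E_ℓ)` of a simple function `s = ∑_ℓ S_ℓ χ_{E_ℓ}`. -/
def simpleIntegral (P : Set (halfPlane ι) → BoundedOp H) (L : ℍ → BoundedOp H)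
    (s : MeasureTheory.SimpleFunc (halfPlane ι) ℍ) : BoundedOp H :=
  ∑ q ∈ s.range, L q * P (s ⁻¹' {q})

/-- Convergence in the operator norm of `𝔅(H)`. -/
def TendstoInOpNorm (S : ℕ → BoundedOp H) (T : BoundedOp H) : Prop :=
  ∀ ε : ℝ, 0 < ε → ∃ n₀ : ℕ, ∀ n ≥ n₀, ∀ u : H, ‖S n u - T u‖ ≤ ε * ‖u‖

/-- `T` is the integral over `ℂ_ι⁺` of `φ`, a function that is bounded and measurable on the support
`Γ` of `P`, with respect to `(P, L)`: `T` is the limit in the operator norm of the integrals of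
simple functions that converge uniformly to the function equal to `φ` on `Γ` and to `0` off `Γ`.
(The existence of such simple functions forces `φ` to be bounded and measurable on `Γ`; the
limit does not depend on them.) -/
def HasIntegral (P : Set (halfPlane ι) → BoundedOp H) (L : ℍ → BoundedOp H)
    (φ : halfPlane ι → ℍ) (T : BoundedOp H) : Prop :=
  ∃ s : ℕ → MeasureTheory.SimpleFunc (halfPlane ι) ℍ,
    TendstoUniformly (fun n => ⇑(s n)) ((pvmSupport P).indicator φ) Filter.atTop ∧
    TendstoInOpNorm (fun n => simpleIntegral P L (s n)) T

/-- `P` is the qPVM associated with `T` by the spectral theorem: the unique qPVM that, for some left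
scalar multiplication `L`, is the first component of a bounded iqPVM `(P, L)` with
`T = ∫ id d(P, L)`, where `id : ℂ_ι⁺ → ℍ` is the inclusion map. -/
def IsAssociatedQPVM (P : Set (halfPlane ι) → BoundedOp H) (T : BoundedOp H) : Prop :=
  Bornology.IsBounded (pvmSupport P) ∧
    ∃ L : ℍ → BoundedOp H, IsIQPVM P L ∧ HasIntegral P L (fun z => (z : ℍ)) T

end PVM

end QuaternionicSpectral

end

open QuaternionicSpectral

/-!
A right linear operator is a real linear operator on the underlying real Hilbert space, and a left
scalar multiplication is a `*`-representation `L` of `ℍ` there. Real functions have the same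
integral against `(P, L)` for every `L`, since `L r = r` for real `r`.

The conditions (i)–(iii) are necessary because `ιz = zι`, `jz = (star z)j` and
`-ι(z - star z) = 2β ≥ 0` for `z = α + ιβ` in the half plane. Conversely, `T + T*` and `-(T - T*)²`
are the integrals of `2α` and `4β²`. By (i) and (ii) they commute with `L ι` and `L j`, hence so do
their spectral projections, and these generate `P` because `β ≥ 0`. As `ι` and `j` generate `ℍ`, all
of `L` commutes with `P`.
Finally, if `L₀` is a left multiplication with `T = ∫ id d(P, L₀)`, the operators `-L ι (T - T*)`
and `-L₀ ι (T - T*)` are commuting square roots of `-(T - T*)²`, both positive by (iii), so they are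
equal. Thus `-L ι (T - T*)` is the integral of `2β`, and integrating `α + ιβ` against `(P, L)`
gives `T`.
-/

namespace QuaternionicSpectral

open MeasureTheory Filter Topology QuaternionicHilbertSpace

section Operator

variable {E : Type*} [NormedAddCommGroup E] [InnerProductSpace ℝ E] [CompleteSpace E]

theorem norm_le_of_star_mul_self_add_eq {A B : E →L[ℝ] E} {M : ℝ} (hM : 0 ≤ M)
    (h : star A * A + star B * B = algebraMap ℝ (E →L[ℝ] E) (M ^ 2)) : ‖A‖ ≤ M := by
  refine A.opNorm_le_bound hM fun u => ?_
  have hsum : ‖A u‖ ^ 2 + ‖B u‖ ^ 2 = (M * ‖u‖) ^ 2 := by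
    rw [A.apply_norm_sq_eq_inner_adjoint_right, B.apply_norm_sq_eq_inner_adjoint_right, ← map_add,
      ← inner_add_right, ← add_apply]
    change inner ℝ u ((star A * A + star B * B) u) = _
    rw [h, Algebra.algebraMap_eq_smul_one, smul_apply, one_apply_eq_self, inner_smul_right,
      real_inner_self_eq_norm_sq, mul_pow]
  rw [← sq_le_sq₀ (norm_nonneg _) (by positivity), ← hsum]
  exact le_add_of_nonneg_right (sq_nonneg _)

theorem eq_of_isPositive_of_sq_eq {A B : E →L[ℝ] E} (hA : A.IsPositive) (hB : B.IsPositive)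
    (hAB : Commute A B) (h : A * A = B * B) : A = B := by
  set D := A - B
  have hD : IsSelfAdjoint D := hA.isSelfAdjoint.sub hB.isSelfAdjoint
  have hconj {S : E →L[ℝ] E} (hS : S.IsPositive) : 0 ≤ D * S * D := by
    rw [ContinuousLinearMap.nonneg_iff_isPositive]
    convert hS.conj_adjoint D using 1
    rw [← ContinuousLinearMap.star_eq_adjoint, hD.star_eq]
    rfl
  have hsum : D * A * D + D * B * D = 0 := by
    rw [← add_mul, ← mul_add, ← hAB.mul_self_sub_mul_self_eq', h, sub_self, zero_mul]
  have hDA : D * A * D = 0 := by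
    refine le_antisymm ?_ (hconj hA)
    rw [ContinuousLinearMap.le_def, zero_sub, ← eq_neg_of_add_eq_zero_right hsum]
    exact (ContinuousLinearMap.nonneg_iff_isPositive _).1 (hconj hB)
  have hDB : D * B * D = 0 := by rwa [hDA, zero_add] at hsum
  have hcube : D * D * D = 0 := by
    rw [mul_sub D A B, sub_mul, hDA, hDB, sub_zero]
  have hfourth : ‖D‖ ^ 2 ^ 2 = 0 := by
    rw [← hD.norm_pow_two_pow, norm_eq_zero]
    exact pow_eq_zero_of_le (show 3 ≤ 2 ^ 2 by norm_num) ((pow_three' D).trans hcube)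
  exact sub_eq_zero.1 (norm_eq_zero.1 (pow_eq_zero_iff (by norm_num) |>.1 hfourth))

end Operator

section ProjectionValuedMeasure

variable {E : Type*} [NormedAddCommGroup E] [InnerProductSpace ℝ E] [CompleteSpace E]
  {Ω : Type*} [MeasurableSpace Ω]

/-- A projection-valued measure on a real Hilbert space: countably additive in the strong operator
topology.  Only the values at measurable sets matter. -/
structure IsProjectionValuedMeasure (P : Set Ω → E →L[ℝ] E) : Prop where
  univ : P Set.univ = 1
  inter : ∀ A B, MeasurableSet A → MeasurableSet B → P A * P B = P (A ∩ B)
  isSelfAdjoint : ∀ A, MeasurableSet A → IsSelfAdjoint (P A)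
  hasSum_iUnion : ∀ A : ℕ → Set Ω, (∀ n, MeasurableSet (A n)) →
    Pairwise (Function.onFun Disjoint A) → ∀ u, HasSum (fun n => P (A n) u) (P (⋃ n, A n) u)

namespace IsProjectionValuedMeasure

variable {P : Set Ω → E →L[ℝ] E}

theorem empty (hP : IsProjectionValuedMeasure P) : P ∅ = 0 := by
  ext u
  have h := hP.hasSum_iUnion (fun _ => ∅) (fun _ => .empty) (fun _ _ _ => disjoint_bot_left) u
  exact (summable_const_iff _).1 h.summable

open Classical in
/-- The `E`-valued measure `A ↦ P A u`. -/
noncomputable def vectorMeasure (hP : IsProjectionValuedMeasure P) (u : E) : VectorMeasure Ω E where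
  measureOf' A := if MeasurableSet A then P A u else 0
  empty' := by rw [if_pos .empty, hP.empty, zero_apply]
  not_measurable' _ hA := if_neg hA
  m_iUnion' A hA hd := by
    simpa only [hA, MeasurableSet.iUnion hA, if_true] using hP.hasSum_iUnion A hA hd u

theorem vectorMeasure_apply (hP : IsProjectionValuedMeasure P) (u : E) {A : Set Ω}
    (hA : MeasurableSet A) : hP.vectorMeasure u A = P A u := if_pos hA

theorem union (hP : IsProjectionValuedMeasure P) {A B : Set Ω} (hA : MeasurableSet A)
    (hB : MeasurableSet B) (h : Disjoint A B) : P (A ∪ B) = P A + P B := by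
  ext u
  rw [add_apply, ← hP.vectorMeasure_apply u hA, ← hP.vectorMeasure_apply u hB,
    ← hP.vectorMeasure_apply u (hA.union hB), VectorMeasure.of_union h hA hB]

theorem add_compl (hP : IsProjectionValuedMeasure P) {A : Set Ω} (hA : MeasurableSet A) :
    P A + P Aᶜ = 1 := by
  rw [← hP.union hA hA.compl disjoint_compl_right, Set.union_compl_self, hP.univ]

theorem compl_eq (hP : IsProjectionValuedMeasure P) {A : Set Ω} (hA : MeasurableSet A) :
    P Aᶜ = 1 - P A := eq_sub_of_add_eq' (hP.add_compl hA)

theorem isIdempotentElem (hP : IsProjectionValuedMeasure P) {A : Set Ω} (hA : MeasurableSet A) :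
    IsIdempotentElem (P A) := by
  rw [IsIdempotentElem, hP.inter A A hA hA, Set.inter_self]

theorem mul_eq_zero (hP : IsProjectionValuedMeasure P) {A B : Set Ω} (hA : MeasurableSet A)
    (hB : MeasurableSet B) (h : Disjoint A B) : P A * P B = 0 := by
  rw [hP.inter A B hA hB, h.inter_eq, hP.empty]

theorem inter_eq_of_compl_eq_zero (hP : IsProjectionValuedMeasure P) {A B : Set Ω}
    (hA : MeasurableSet A) (hB : MeasurableSet B) (h : P Bᶜ = 0) : P (A ∩ B) = P A := by
  rw [← hP.inter A B hA hB, ← add_zero (P B), ← h, hP.add_compl hB, mul_one]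

theorem preimage_indicator {β : Type*} [MeasurableSpace β] [Zero β]
    (hP : IsProjectionValuedMeasure P) {f : Ω → β} (hf : Measurable f) {A : Set Ω}
    (hA : MeasurableSet A) (h : P Aᶜ = 0) {B : Set β} (hB : MeasurableSet B) :
    P (A.indicator f ⁻¹' B) = P (f ⁻¹' B) := by
  rw [← hP.inter_eq_of_compl_eq_zero (hf.indicator hA hB) hA h,
    ← hP.inter_eq_of_compl_eq_zero (hf hB) hA h]
  congr 1
  ext x
  refine and_congr_left fun hx => ?_
  rw [Set.mem_preimage, Set.indicator_of_mem hx, Set.mem_preimage]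

theorem hasSum_disjointed (hP : IsProjectionValuedMeasure P) {A : ℕ → Set Ω}
    (hA : ∀ n, MeasurableSet (A n)) (u : E) :
    HasSum (fun n => P (disjointed A n) u) (P (⋃ n, A n) u) := by
  simpa only [iUnion_disjointed] using
    hP.hasSum_iUnion (disjointed A) (.disjointed hA) (disjoint_disjointed A) u

theorem iUnion_apply_eq_zero (hP : IsProjectionValuedMeasure P) {A : ℕ → Set Ω}
    (hA : ∀ n, MeasurableSet (A n)) {u : E} (h : ∀ n, P (A n) u = 0) : P (⋃ n, A n) u = 0 := by
  have hzero (n : ℕ) : P (disjointed A n) u = 0 := by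
    rw [← Set.inter_eq_left.2 (disjointed_subset A n), ← hP.inter _ _ (.disjointed hA n) (hA n),
      mul_apply_eq_comp, h, map_zero]
  have hsum := hP.hasSum_disjointed hA u
  simp only [hzero] at hsum
  exact hsum.unique hasSum_zero

theorem sUnion_isOpen_eq_zero [TopologicalSpace Ω] [OpensMeasurableSpace Ω]
    [SecondCountableTopology Ω] (hP : IsProjectionValuedMeasure P) :
    P (⋃₀ {O | IsOpen O ∧ P O = 0}) = 0 := by
  obtain ⟨S, hS, hSsub, hSU⟩ :=
    TopologicalSpace.isOpen_sUnion_countable {O | IsOpen O ∧ P O = 0} fun _ h => h.1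
  rw [← hSU]
  rcases S.eq_empty_or_nonempty with rfl | hne
  · rw [Set.sUnion_empty, hP.empty]
  obtain ⟨O, rfl⟩ := hS.exists_eq_range hne
  have hO (n : ℕ) : IsOpen (O n) ∧ P (O n) = 0 := hSsub (Set.mem_range_self n)
  ext u
  rw [Set.sUnion_range]
  refine hP.iUnion_apply_eq_zero (fun n => (hO n).1.measurableSet) fun n => ?_
  rw [(hO n).2, zero_apply]

theorem commute_disjointed (hP : IsProjectionValuedMeasure P) {X : E →L[ℝ] E} {A : ℕ → Set Ω}
    (hA : ∀ n, MeasurableSet (A n)) (h : ∀ n, Commute (P (A n)) X) (n : ℕ) :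
    Commute (P (disjointed A n)) X := by
  refine (disjointedRec (p := fun B => MeasurableSet B ∧ Commute (P B) X) ?_ ⟨hA n, h n⟩).2
  rintro B i ⟨hB, hBX⟩
  refine ⟨hB.diff (hA i), ?_⟩
  rw [Set.sdiff_eq, ← hP.inter B _ hB (hA i).compl, hP.compl_eq (hA i)]
  exact hBX.mul_left ((Commute.one_left X).sub_left (h i))

theorem commute_iUnion (hP : IsProjectionValuedMeasure P) {X : E →L[ℝ] E} {A : ℕ → Set Ω}
    (hA : ∀ n, MeasurableSet (A n)) (h : ∀ n, Commute (P (A n)) X) :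
    Commute (P (⋃ n, A n)) X := by
  ext u
  have hcomm (n : ℕ) : P (disjointed A n) (X u) = X (P (disjointed A n) u) :=
    DFunLike.congr_fun (hP.commute_disjointed hA h n).eq u
  have hsum := hP.hasSum_disjointed hA (X u)
  simp only [hcomm] at hsum
  exact hsum.unique (X.hasSum (hP.hasSum_disjointed hA u))

/-- The `σ`-algebra of the measurable sets whose projection commutes with a given operator. -/
@[reducible]
def commutingMeasurableSpace (hP : IsProjectionValuedMeasure P) (X : E →L[ℝ] E) :
    MeasurableSpace Ω where
  MeasurableSet' A := MeasurableSet A ∧ Commute (P A) X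
  measurableSet_empty := ⟨.empty, hP.empty ▸ Commute.zero_left X⟩
  measurableSet_compl _ hA :=
    ⟨hA.1.compl, hP.compl_eq hA.1 ▸ (Commute.one_left X).sub_left hA.2⟩
  measurableSet_iUnion _ hA :=
    ⟨.iUnion fun n => (hA n).1, hP.commute_iUnion (fun n => (hA n).1) fun n => (hA n).2⟩

end IsProjectionValuedMeasure

end ProjectionValuedMeasure

section SpectralIntegral

variable {E : Type*} [NormedAddCommGroup E] [InnerProductSpace ℝ E] [CompleteSpace E]
  {Ω : Type*} {P : Set Ω → E →L[ℝ] E} {L : ℍ →⋆ₐ[ℝ] (E →L[ℝ] E)}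

/-- The operator-valued set function `A ↦ (q ↦ L q * P A)` against which quaternionic functions
are integrated. -/
noncomputable def leftMulMeasure (P : Set Ω → E →L[ℝ] E) (L : ℍ →⋆ₐ[ℝ] (E →L[ℝ] E)) (A : Set Ω) :
    ℍ →L[ℝ] (E →L[ℝ] E) :=
  LinearMap.toContinuousLinearMap ((LinearMap.mulRight ℝ (P A)).comp L.toAlgHom.toLinearMap)

theorem leftMulMeasure_apply (A : Set Ω) (q : ℍ) : leftMulMeasure P L A q = L q * P A := rfl

variable [MeasurableSpace Ω]

/-- `P` is a projection-valued measure intertwined with a representation `L` of the quaternions on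
the same real Hilbert space. -/
structure IsIntertwiningMeasure (P : Set Ω → E →L[ℝ] E) (L : ℍ →⋆ₐ[ℝ] (E →L[ℝ] E)) : Prop
    extends IsProjectionValuedMeasure P where
  commute : ∀ A, MeasurableSet A → ∀ q, Commute (L q) (P A)

/-- The integral `∑ q, L q * P {s = q}` of a simple function `s`. -/
noncomputable def simpleSpectralIntegral (P : Set Ω → E →L[ℝ] E) (L : ℍ →⋆ₐ[ℝ] (E →L[ℝ] E))
    (s : SimpleFunc Ω ℍ) : E →L[ℝ] E :=
  s.setToSimpleFunc (leftMulMeasure P L)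

theorem simpleSpectralIntegral_eq_sum (s : SimpleFunc Ω ℍ) :
    simpleSpectralIntegral P L s = ∑ q ∈ s.range, L q * P (s ⁻¹' {q}) := rfl

namespace IsProjectionValuedMeasure

theorem leftMulMeasure_empty (hP : IsProjectionValuedMeasure P) : leftMulMeasure P L ∅ = 0 := by
  ext1 q
  rw [leftMulMeasure_apply, hP.empty, mul_zero, zero_apply]

/-- With respect to the measure `0`, finite additivity is additivity on all measurable sets. -/
theorem finMeasAdditive_leftMulMeasure (hP : IsProjectionValuedMeasure P) :
    FinMeasAdditive (0 : Measure Ω) (leftMulMeasure P L) := fun A B hA hB _ _ hAB => by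
  ext1 q
  rw [add_apply, leftMulMeasure_apply, leftMulMeasure_apply, leftMulMeasure_apply,
    hP.union hA hB hAB, mul_add]

theorem simpleSpectralIntegral_map (hP : IsProjectionValuedMeasure P) {β : Type*}
    [NormedAddCommGroup β] (s : SimpleFunc Ω β) {f : β → ℍ} (hf : f 0 = 0) :
    simpleSpectralIntegral P L (s.map f) = ∑ b ∈ s.range, L (f b) * P (s ⁻¹' {b}) :=
  SimpleFunc.map_setToSimpleFunc _ hP.finMeasAdditive_leftMulMeasure integrable_zero_measure hf

theorem simpleSpectralIntegral_add (hP : IsProjectionValuedMeasure P) (s t : SimpleFunc Ω ℍ) :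
    simpleSpectralIntegral P L (s + t) =
      simpleSpectralIntegral P L s + simpleSpectralIntegral P L t :=
  SimpleFunc.setToSimpleFunc_add _ hP.finMeasAdditive_leftMulMeasure integrable_zero_measure
    integrable_zero_measure

theorem simpleSpectralIntegral_const (hP : IsProjectionValuedMeasure P) (q : ℍ) :
    simpleSpectralIntegral P L (SimpleFunc.const Ω q) = L q := by
  rw [simpleSpectralIntegral, SimpleFunc.setToSimpleFunc_const _ hP.leftMulMeasure_empty,
    leftMulMeasure_apply, hP.univ, mul_one]

theorem simpleSpectralIntegral_indicator (hP : IsProjectionValuedMeasure P) {A : Set Ω}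
    (hA : MeasurableSet A) :
    simpleSpectralIntegral P L (.piecewise A hA (.const Ω 1) (.const Ω 0)) = P A := by
  rw [simpleSpectralIntegral, SimpleFunc.setToSimpleFunc_indicator _ hP.leftMulMeasure_empty,
    leftMulMeasure_apply, map_one, one_mul]

end IsProjectionValuedMeasure

namespace IsIntertwiningMeasure

theorem simpleSpectralIntegral_mul (h : IsIntertwiningMeasure P L) (s t : SimpleFunc Ω ℍ) :
    simpleSpectralIntegral P L (s * t) =
      simpleSpectralIntegral P L s * simpleSpectralIntegral P L t := by
  set p := s.pair t
  have hmeas (b : ℍ × ℍ) : MeasurableSet (p ⁻¹' {b}) := p.measurableSet_fiber b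
  have hmove (b c : ℍ × ℍ) : L b.1 * P (p ⁻¹' {b}) * (L c.2 * P (p ⁻¹' {c})) =
      L (b.1 * c.2) * (P (p ⁻¹' {b}) * P (p ⁻¹' {c})) := by
    rw [mul_assoc, ← mul_assoc (P _), ← (h.commute _ (hmeas b) _).eq, map_mul, mul_assoc, mul_assoc]
  have hdiag (b : ℍ × ℍ) : L b.1 * P (p ⁻¹' {b}) * (L b.2 * P (p ⁻¹' {b})) =
      L (b.1 * b.2) * P (p ⁻¹' {b}) := by
    rw [hmove, (h.isIdempotentElem (hmeas b)).eq]
  have hoff (b c : ℍ × ℍ) (hbc : c ≠ b) : L b.1 * P (p ⁻¹' {b}) * (L c.2 * P (p ⁻¹' {c})) = 0 := by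
    rw [hmove, h.mul_eq_zero (hmeas b) (hmeas c)
      ((Set.disjoint_singleton.2 hbc.symm).preimage p), mul_zero]
  calc simpleSpectralIntegral P L (p.map fun b => b.1 * b.2)
      = ∑ b ∈ p.range, L (b.1 * b.2) * P (p ⁻¹' {b}) := h.simpleSpectralIntegral_map p (mul_zero 0)
    _ = ∑ b ∈ p.range, ∑ c ∈ p.range, L b.1 * P (p ⁻¹' {b}) * (L c.2 * P (p ⁻¹' {c})) :=
        Finset.sum_congr rfl fun b hb => by
          rw [Finset.sum_eq_single_of_mem b hb fun c _ hcb => hoff b c hcb, hdiag]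
    _ = simpleSpectralIntegral P L (p.map Prod.fst) *
          simpleSpectralIntegral P L (p.map Prod.snd) := by
        rw [← Finset.sum_mul_sum, h.simpleSpectralIntegral_map p rfl,
          h.simpleSpectralIntegral_map p rfl]

theorem simpleSpectralIntegral_star (h : IsIntertwiningMeasure P L) (s : SimpleFunc Ω ℍ) :
    simpleSpectralIntegral P L (s.map star) = star (simpleSpectralIntegral P L s) := by
  rw [h.simpleSpectralIntegral_map s (star_zero ℍ), simpleSpectralIntegral_eq_sum, star_sum]
  refine Finset.sum_congr rfl fun q _ => ?_
  have hA := s.measurableSet_fiber q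
  rw [star_mul, (h.isSelfAdjoint _ hA).star_eq, ← map_star, (h.commute _ hA _).eq]

/-- If `t = √(M² - ‖s‖²)` then `s* s + t* t = M²`, and integrating this identity gives
`‖(∫ s) u‖² + ‖(∫ t) u‖² = M² ‖u‖²`. -/
theorem norm_simpleSpectralIntegral_le (h : IsIntertwiningMeasure P L) {s : SimpleFunc Ω ℍ} {M : ℝ}
    (hM : 0 ≤ M) (hs : ∀ x, ‖s x‖ ≤ M) : ‖simpleSpectralIntegral P L s‖ ≤ M := by
  set t : SimpleFunc Ω ℍ := s.map fun q => (√(M ^ 2 - ‖q‖ ^ 2) : ℝ)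
  have hst : s.map star * s + t.map star * t = SimpleFunc.const Ω ((M ^ 2 : ℝ) : ℍ) := by
    ext1 x
    have hx : 0 ≤ M ^ 2 - ‖s x‖ ^ 2 := by
      rw [sub_nonneg]
      exact pow_le_pow_left₀ (norm_nonneg _) (hs x) 2
    simp only [t, SimpleFunc.coe_add, SimpleFunc.coe_mul, SimpleFunc.coe_map, Pi.add_apply,
      Pi.mul_apply, Function.comp_apply, SimpleFunc.const_apply, Quaternion.star_coe,
      Quaternion.star_mul_self, Quaternion.normSq_eq_norm_mul_self, ← Quaternion.coe_mul,
      ← Quaternion.coe_add, Real.mul_self_sqrt hx]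
    congr 1
    ring
  refine norm_le_of_star_mul_self_add_eq hM (B := simpleSpectralIntegral P L t) ?_
  have hint := congrArg (simpleSpectralIntegral P L) hst
  rw [h.simpleSpectralIntegral_add, h.simpleSpectralIntegral_mul, h.simpleSpectralIntegral_mul,
    h.simpleSpectralIntegral_star, h.simpleSpectralIntegral_star,
    h.simpleSpectralIntegral_const] at hint
  rw [hint]
  exact AlgHomClass.commutes L _

end IsIntertwiningMeasure

end SpectralIntegral

section Integral

variable {E : Type*} [NormedAddCommGroup E] [InnerProductSpace ℝ E] [CompleteSpace E]
  {Ω : Type*} [MeasurableSpace Ω]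

/-- `G = ∫ φ d(P, L)`: `G` is the limit in operator norm of the integrals of simple functions that
converge uniformly to `φ`. -/
def HasSpectralIntegral (P : Set Ω → E →L[ℝ] E) (L : ℍ →⋆ₐ[ℝ] (E →L[ℝ] E)) (φ : Ω → ℍ)
    (G : E →L[ℝ] E) : Prop :=
  ∃ s : ℕ → SimpleFunc Ω ℍ, TendstoUniformly (fun n => ⇑(s n)) φ atTop ∧
    Tendsto (fun n => simpleSpectralIntegral P L (s n)) atTop (𝓝 G)

variable {P : Set Ω → E →L[ℝ] E} {L : ℍ →⋆ₐ[ℝ] (E →L[ℝ] E)} {φ ψ : Ω → ℍ} {F G : E →L[ℝ] E}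

theorem hasSpectralIntegral_simpleFunc (s : SimpleFunc Ω ℍ) :
    HasSpectralIntegral P L s (simpleSpectralIntegral P L s) :=
  ⟨fun _ => s, fun _ hV => .of_forall fun _ _ => refl_mem_uniformity hV, tendsto_const_nhds⟩

namespace HasSpectralIntegral

theorem measurable [MeasurableSpace ℍ] [BorelSpace ℍ]
    (hG : HasSpectralIntegral P L φ G) : Measurable φ := by
  obtain ⟨s, hs, -⟩ := hG
  exact measurable_of_tendsto_metrizable (fun n => (s n).measurable)
    (tendsto_pi_nhds.2 fun x => hs.tendsto_at x)

theorem exists_norm_le (hG : HasSpectralIntegral P L φ G) : ∃ M : ℝ, 0 ≤ M ∧ ∀ x, ‖φ x‖ ≤ M := by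
  obtain ⟨s, hs, -⟩ := hG
  obtain ⟨n, hn⟩ := (Metric.tendstoUniformly_iff.1 hs 1 one_pos).exists
  obtain ⟨C, hC⟩ := (s n).finite_range.isBounded.exists_norm_le
  refine ⟨|C| + 1, by positivity, fun x => ?_⟩
  have hx : ‖φ x - s n x‖ < 1 := by simpa only [dist_eq_norm] using hn x
  have hCx : ‖s n x‖ ≤ |C| := (hC _ ⟨x, rfl⟩).trans (le_abs_self C)
  linarith [norm_le_norm_add_norm_sub' (φ x) (s n x)]

theorem add (hP : IsProjectionValuedMeasure P) (hF : HasSpectralIntegral P L φ F)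
    (hG : HasSpectralIntegral P L ψ G) : HasSpectralIntegral P L (fun x => φ x + ψ x) (F + G) := by
  obtain ⟨s, hs, hsF⟩ := hF
  obtain ⟨t, ht, htG⟩ := hG
  refine ⟨fun n => s n + t n, hs.add ht, ?_⟩
  simp only [hP.simpleSpectralIntegral_add]
  exact hsF.add htG

end HasSpectralIntegral

theorem tendstoUniformly_mul_of_norm_le {α ι A : Type*} [NormedRing A] [ProperSpace A]
    {l : Filter ι} {f g : ι → α → A} {φ ψ : α → A} {M : ℝ} (hφ : ∀ x, ‖φ x‖ ≤ M)
    (hψ : ∀ x, ‖ψ x‖ ≤ M) (hf : TendstoUniformly f φ l) (hg : TendstoUniformly g ψ l) :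
    TendstoUniformly (fun i x => f i x * g i x) (fun x => φ x * ψ x) l := by
  have hbound (x : α) : (φ x, ψ x) ∈ Metric.closedBall (0 : A × A) M :=
    mem_closedBall_zero_iff.2 (max_le (hφ x) (hψ x))
  have hfg : TendstoUniformly (fun i x => (f i x, g i x)) (fun x => (φ x, ψ x)) l := fun V hV =>
    (hf.prodMk hg V hV).diag_of_prod
  have hmul : UniformContinuousOn (fun p : A × A => p.1 * p.2) (Metric.closedBall 0 (M + 1)) :=
    (isCompact_closedBall _ _).uniformContinuousOn_of_continuous continuous_mul.continuousOn
  refine hmul.comp_tendstoUniformly_eventually ?_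
    (fun x => Metric.closedBall_subset_closedBall (by linarith) (hbound x)) hfg
  filter_upwards [Metric.tendstoUniformly_iff.1 hfg 1 one_pos] with i hi x
  have hx : dist (f i x, g i x) (φ x, ψ x) ≤ 1 := (dist_comm _ _).trans_le (hi x).le
  exact (dist_triangle _ _ _).trans (by linarith [Metric.mem_closedBall.1 (hbound x)])

namespace IsProjectionValuedMeasure

theorem hasSpectralIntegral_const (hP : IsProjectionValuedMeasure P) (q : ℍ) :
    HasSpectralIntegral P L (fun _ => q) (L q) := by
  rw [← hP.simpleSpectralIntegral_const q]
  exact hasSpectralIntegral_simpleFunc (SimpleFunc.const Ω q)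

theorem hasSpectralIntegral_indicator (hP : IsProjectionValuedMeasure P) {A : Set Ω}
    (hA : MeasurableSet A) : HasSpectralIntegral P L (A.indicator 1) (P A) := by
  rw [← hP.simpleSpectralIntegral_indicator (L := L) hA]
  convert hasSpectralIntegral_simpleFunc _ using 1
  simp

end IsProjectionValuedMeasure

namespace HasSpectralIntegral

theorem mul (h : IsIntertwiningMeasure P L) (hF : HasSpectralIntegral P L φ F)
    (hG : HasSpectralIntegral P L ψ G) : HasSpectralIntegral P L (fun x => φ x * ψ x) (F * G) := by
  obtain ⟨M, hM, hφ⟩ := hF.exists_norm_le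
  obtain ⟨N, hN, hψ⟩ := hG.exists_norm_le
  obtain ⟨s, hs, hsF⟩ := hF
  obtain ⟨t, ht, htG⟩ := hG
  refine ⟨fun n => s n * t n, tendstoUniformly_mul_of_norm_le (M := M + N)
    (fun x => (hφ x).trans (by linarith)) (fun x => (hψ x).trans (by linarith)) hs ht, ?_⟩
  simp only [h.simpleSpectralIntegral_mul]
  exact hsF.mul htG

protected theorem star (h : IsIntertwiningMeasure P L) (hF : HasSpectralIntegral P L φ F) :
    HasSpectralIntegral P L (fun x => star (φ x)) (star F) := by
  obtain ⟨s, hs, hsF⟩ := hF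
  refine ⟨fun n => (s n).map Star.star,
    UniformContinuous.comp_tendstoUniformly (star_isometry.uniformContinuous) hs, ?_⟩
  simp only [h.simpleSpectralIntegral_star]
  exact hsF.star

theorem const_mul (h : IsIntertwiningMeasure P L) (q : ℍ) (hF : HasSpectralIntegral P L φ F) :
    HasSpectralIntegral P L (fun x => q * φ x) (L q * F) :=
  (h.hasSpectralIntegral_const q).mul h hF

theorem mul_const (h : IsIntertwiningMeasure P L) (q : ℍ) (hF : HasSpectralIntegral P L φ F) :
    HasSpectralIntegral P L (fun x => φ x * q) (F * L q) :=
  hF.mul h (h.hasSpectralIntegral_const q)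

theorem sub (h : IsIntertwiningMeasure P L) (hF : HasSpectralIntegral P L φ F)
    (hG : HasSpectralIntegral P L ψ G) : HasSpectralIntegral P L (fun x => φ x - ψ x) (F - G) := by
  simpa only [map_neg, map_one, neg_mul, one_mul, ← sub_eq_add_neg]
    using hF.add h.1 (hG.const_mul h (-1))

theorem norm_le (h : IsIntertwiningMeasure P L) (hF : HasSpectralIntegral P L φ F) {M : ℝ}
    (hM : 0 ≤ M) (hφ : ∀ x, ‖φ x‖ ≤ M) : ‖F‖ ≤ M := by
  obtain ⟨s, hs, hsF⟩ := hF
  refine le_of_forall_pos_le_add fun ε hε => le_of_tendsto hsF.norm ?_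
  filter_upwards [Metric.tendstoUniformly_iff.1 hs ε hε] with n hn
  refine h.norm_simpleSpectralIntegral_le (by positivity) fun x => ?_
  have hx : ‖φ x - s n x‖ < ε := by simpa only [dist_eq_norm] using hn x
  linarith [norm_le_norm_add_norm_sub (φ x) (s n x), hφ x]

theorem unique (h : IsIntertwiningMeasure P L) (hF : HasSpectralIntegral P L φ F)
    (hG : HasSpectralIntegral P L φ G) : F = G := by
  rw [← sub_eq_zero, ← norm_le_zero_iff]
  exact (hF.sub h hG).norm_le h le_rfl fun x => by rw [sub_self, norm_zero]

theorem tendsto (h : IsIntertwiningMeasure P L) (hF : HasSpectralIntegral P L φ F)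
    {s : ℕ → SimpleFunc Ω ℍ} (hs : TendstoUniformly (fun n => ⇑(s n)) φ atTop) :
    Tendsto (fun n => simpleSpectralIntegral P L (s n)) atTop (𝓝 F) := by
  rw [Metric.tendsto_nhds]
  intro ε hε
  filter_upwards [Metric.tendstoUniformly_iff.1 hs (ε / 2) (by positivity)] with n hn
  rw [dist_comm, dist_eq_norm]
  refine lt_of_le_of_lt ((hF.sub h (hasSpectralIntegral_simpleFunc (s n))).norm_le h
    (by positivity) fun x => ?_) (half_lt_self hε)
  simpa only [dist_eq_norm] using (hn x).le

theorem commute_projection (h : IsIntertwiningMeasure P L) (hF : HasSpectralIntegral P L φ F)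
    {A : Set Ω} (hA : MeasurableSet A) : Commute F (P A) := by
  refine HasSpectralIntegral.unique h (hF.mul h (h.hasSpectralIntegral_indicator hA)) ?_
  convert (h.hasSpectralIntegral_indicator hA).mul h hF using 2 with x
  by_cases hx : x ∈ A <;> simp [hx]

theorem norm_mul_projection_le (h : IsIntertwiningMeasure P L) (hF : HasSpectralIntegral P L φ F)
    {A : Set Ω} (hA : MeasurableSet A) {M : ℝ} (hM : 0 ≤ M) (hφ : ∀ x ∈ A, ‖φ x‖ ≤ M) :
    ‖F * P A‖ ≤ M := by
  refine (hF.mul h (h.hasSpectralIntegral_indicator hA)).norm_le h hM fun x => ?_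
  by_cases hx : x ∈ A
  · simpa [hx] using hφ x hx
  · simpa [hx] using hM

end HasSpectralIntegral

theorem IsIntertwiningMeasure.norm_projection_le_one (h : IsIntertwiningMeasure P L) {A : Set Ω}
    (hA : MeasurableSet A) : ‖P A‖ ≤ 1 := by
  simpa only [map_one, one_mul] using
    (h.hasSpectralIntegral_const 1).norm_mul_projection_le h hA zero_le_one fun _ _ => norm_one.le

end Integral

section RealIntegrand

open Polynomial

variable {E : Type*} [NormedAddCommGroup E] [InnerProductSpace ℝ E] [CompleteSpace E]
  {Ω : Type*} [MeasurableSpace Ω] {P : Set Ω → E →L[ℝ] E} {L : ℍ →⋆ₐ[ℝ] (E →L[ℝ] E)}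
  {g : Ω → ℝ} {G X : E →L[ℝ] E}

namespace HasSpectralIntegral

theorem measurable_of_real (hG : HasSpectralIntegral P L (fun x => (g x : ℍ)) G) :
    Measurable g := by
  borelize ℍ
  exact Quaternion.continuous_re.measurable.comp hG.measurable

protected theorem aeval (h : IsIntertwiningMeasure P L)
    (hG : HasSpectralIntegral P L (fun x => (g x : ℍ)) G) (p : ℝ[X]) :
    HasSpectralIntegral P L (fun x => ((p.eval (g x) : ℝ) : ℍ)) (Polynomial.aeval G p) := by
  have hconst (a : ℝ) : HasSpectralIntegral P L (fun _ => (a : ℍ)) (algebraMap ℝ _ a) := by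
    rw [← AlgHomClass.commutes L a]
    exact h.hasSpectralIntegral_const a
  induction p using Polynomial.induction_on with
  | C a => simpa only [eval_C, aeval_C] using hconst a
  | add p q hp hq => simpa only [eval_add, map_add, Quaternion.coe_add] using hp.add h.1 hq
  | monomial n a hn =>
    simpa only [pow_succ, ← mul_assoc, eval_mul, eval_X, map_mul, aeval_X, Quaternion.coe_mul]
      using hn.mul h hG

theorem isSelfAdjoint (h : IsIntertwiningMeasure P L)
    (hG : HasSpectralIntegral P L (fun x => (g x : ℍ)) G) : IsSelfAdjoint G :=
  HasSpectralIntegral.unique h (by simpa only [Quaternion.star_coe] using hG.star h) hG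

/-- If `0 ≤ g ≤ M` then `‖M - g‖ ≤ M`, hence `‖M - G‖ ≤ M`. -/
theorem isPositive (h : IsIntertwiningMeasure P L)
    (hG : HasSpectralIntegral P L (fun x => (g x : ℍ)) G) (hg : ∀ x, 0 ≤ g x) : G.IsPositive := by
  obtain ⟨M, hM, hgM⟩ := hG.exists_norm_le
  have hnorm : ‖L (M : ℍ) - G‖ ≤ M :=
    ((h.hasSpectralIntegral_const (M : ℍ)).sub h hG).norm_le h hM fun x => by
      have hx := (le_abs_self (g x)).trans (Quaternion.norm_coe (g x) ▸ hgM x)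
      rw [← Quaternion.coe_sub, Quaternion.norm_coe, Real.norm_of_nonneg (by linarith)]
      linarith [hg x]
  refine ⟨(hG.isSelfAdjoint h).isSymmetric, fun u => ?_⟩
  have hu := (real_inner_le_norm ((L (M : ℍ) - G) u) u).trans
    (mul_le_mul_of_nonneg_right ((L (M : ℍ) - G).le_of_opNorm_le hnorm u) (norm_nonneg u))
  have hL : L (M : ℍ) u = M • u := DFunLike.congr_fun (AlgHomClass.commutes L M) u
  rw [sub_apply, hL, inner_sub_left, real_inner_smul_left, real_inner_self_eq_norm_mul_norm,
    ← mul_assoc] at hu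
  exact sub_le_self_iff _ |>.1 hu

/-- The integral of a real function does not depend on the representation, as `L r = r` for real
`r`. -/
theorem congr_left (h : IsIntertwiningMeasure P L) {L' : ℍ →⋆ₐ[ℝ] (E →L[ℝ] E)}
    (hG : HasSpectralIntegral P L (fun x => (g x : ℍ)) G) :
    HasSpectralIntegral P L' (fun x => (g x : ℍ)) G := by
  obtain ⟨s, hs, -⟩ := id hG
  let realPart : ℍ →ₗ[ℝ] ℍ := Algebra.linearMap ℝ ℍ ∘ₗ QuaternionAlgebra.reₗ (-1) 0 (-1)
  have hre : UniformContinuous fun q : ℍ => (q.re : ℍ) :=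
    realPart.toContinuousLinearMap.uniformContinuous
  have hs' : TendstoUniformly (fun n => ⇑((s n).map fun q => (q.re : ℍ))) (fun x => (g x : ℍ))
      atTop := hre.comp_tendstoUniformly hs
  have hL (r : ℝ) : L r = L' r := (AlgHomClass.commutes L r).trans (AlgHomClass.commutes L' r).symm
  refine ⟨fun n => (s n).map fun q => (q.re : ℍ), hs', ?_⟩
  convert hG.tendsto h (s := fun n => (s n).map fun q => (q.re : ℍ)) hs' using 2 with n
  simp only [h.simpleSpectralIntegral_map (s n) (f := fun q => (q.re : ℍ)) rfl, hL]

theorem commute_left (h : IsIntertwiningMeasure P L)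
    (hG : HasSpectralIntegral P L (fun x => (g x : ℍ)) G) (q : ℍ) : Commute (L q) G :=
  HasSpectralIntegral.unique h (hG.const_mul h q)
    (by simpa only [Quaternion.coe_commutes] using hG.mul_const h q)

end HasSpectralIntegral

theorem norm_mul_mul_le_of_commute {R : Type*} [NormedRing R] {X Y : R} (hXY : Commute X Y)
    (A B : R) : ‖B * X * A‖ ≤ ‖B * Y‖ * ‖X‖ * ‖A‖ + ‖B‖ * ‖X‖ * ‖(Y - 1) * A‖ := by
  calc ‖B * X * A‖ = ‖B * Y * X * A - B * X * ((Y - 1) * A)‖ := by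
        rw [mul_assoc B Y X, ← hXY.eq]
        congr 1
        noncomm_ring
    _ ≤ ‖B * Y‖ * ‖X‖ * ‖A‖ + ‖B‖ * ‖X‖ * ‖(Y - 1) * A‖ :=
        (norm_sub_le _ _).trans (add_le_add (norm_mul₃_le ..) (norm_mul₃_le ..))

/-- Polynomials in `G` that approximate a cutoff function equal to `1` on `(-∞, r]` and to `0` on
`[t, ∞)` commute with `X` and almost separate the two projections. -/
theorem HasSpectralIntegral.mul_mul_eq_zero_of_commute (h : IsIntertwiningMeasure P L)
    (hG : HasSpectralIntegral P L (fun x => (g x : ℍ)) G) (hX : Commute G X) {r t : ℝ}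
    (hrt : r < t) : P (g ⁻¹' Set.Ici t) * X * P (g ⁻¹' Set.Iic r) = 0 := by
  set A := g ⁻¹' Set.Iic r
  set B := g ⁻¹' Set.Ici t
  have hA : MeasurableSet A := hG.measurable_of_real measurableSet_Iic
  have hB : MeasurableSet B := hG.measurable_of_real measurableSet_Ici
  obtain ⟨M, -, hM⟩ := hG.exists_norm_le
  have hgM (x : Ω) : g x ∈ Set.Icc (-M) M :=
    abs_le.1 (by simpa only [Quaternion.norm_coe, Real.norm_eq_abs] using hM x)
  obtain ⟨f, hfB, hfA, -⟩ := exists_continuous_zero_one_of_isClosed isClosed_Ici isClosed_Iic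
    (Set.Iic_disjoint_Ici.2 hrt.not_ge).symm
  have hbound (ε : ℝ) (hε : 0 < ε) : ‖P B * X * P A‖ ≤ 2 * ‖X‖ * ε := by
    obtain ⟨p, hp⟩ := exists_polynomial_near_of_continuousOn (-M) M f f.continuous.continuousOn ε hε
    set Q := Polynomial.aeval G p
    have hQ : ‖P B * Q‖ ≤ ε := by
      rw [← ((hG.aeval h p).commute_projection h hB).eq]
      refine (hG.aeval h p).norm_mul_projection_le h hB hε.le fun x hx => ?_
      simpa only [hfB hx, Pi.zero_apply, sub_zero, Quaternion.norm_coe, Real.norm_eq_abs]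
        using (hp _ (hgM x)).le
    have hQ' : ‖(Q - 1) * P A‖ ≤ ε := by
      have := (hG.aeval h p).sub h (h.hasSpectralIntegral_const 1)
      rw [map_one] at this
      refine this.norm_mul_projection_le h hA hε.le fun x hx => ?_
      rw [← Quaternion.coe_one, ← Quaternion.coe_sub, Quaternion.norm_coe]
      simpa only [hfA hx, Pi.one_apply, Real.norm_eq_abs] using (hp _ (hgM x)).le
    calc ‖P B * X * P A‖ ≤ ‖P B * Q‖ * ‖X‖ * ‖P A‖ + ‖P B‖ * ‖X‖ * ‖(Q - 1) * P A‖ :=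
          norm_mul_mul_le_of_commute (Algebra.commute_of_mem_adjoin_singleton_of_commute
            (aeval_mem_adjoin_singleton ℝ G) hX.symm) _ _
      _ ≤ ε * ‖X‖ * 1 + 1 * ‖X‖ * ε := by
          gcongr
          · exact h.norm_projection_le_one hA
          · exact h.norm_projection_le_one hB
      _ = 2 * ‖X‖ * ε := by ring
  have hlim : Tendsto (fun ε => 2 * ‖X‖ * ε) (𝓝[>] 0) (𝓝 0) := by
    simpa using ((continuous_const_mul (2 * ‖X‖)).tendsto 0).mono_left nhdsWithin_le_nhds
  exact norm_le_zero_iff.1 (ge_of_tendsto hlim (eventually_mem_nhdsWithin.mono hbound))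

theorem HasSpectralIntegral.compl_mul_mul_eq_zero (h : IsIntertwiningMeasure P L)
    (hG : HasSpectralIntegral P L (fun x => (g x : ℍ)) G) (hX : Commute G X) (r : ℝ) :
    P (g ⁻¹' Set.Iic r)ᶜ * X * P (g ⁻¹' Set.Iic r) = 0 := by
  have hunion : (g ⁻¹' Set.Iic r)ᶜ = ⋃ n : ℕ, g ⁻¹' Set.Ici (r + 1 / (n + 1)) := by
    have hlim : Tendsto (fun n : ℕ => r + 1 / ((n : ℝ) + 1)) atTop (𝓝 r) := by
      simpa only [add_zero] using tendsto_one_div_add_atTop_nhds_zero_nat.const_add r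
    rw [← Set.preimage_compl, Set.compl_Iic, ← Set.preimage_iUnion,
      iUnion_Ici_eq_Ioi_of_lt_of_tendsto
        (fun n => lt_add_of_pos_right r Nat.one_div_pos_of_nat) hlim]
  ext u
  rw [hunion, mul_apply_eq_comp, mul_apply_eq_comp]
  refine h.iUnion_apply_eq_zero (fun n => hG.measurable_of_real measurableSet_Ici) fun n => ?_
  have hn : r < r + 1 / ((n : ℝ) + 1) := lt_add_of_pos_right r Nat.one_div_pos_of_nat
  exact DFunLike.congr_fun (hG.mul_mul_eq_zero_of_commute h hX hn) u

theorem HasSpectralIntegral.commute_preimage_Iic (h : IsIntertwiningMeasure P L)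
    (hG : HasSpectralIntegral P L (fun x => (g x : ℍ)) G) (hX : Commute G X) (r : ℝ) :
    Commute (P (g ⁻¹' Set.Iic r)) X := by
  have hA : MeasurableSet (g ⁻¹' Set.Iic r) := hG.measurable_of_real measurableSet_Iic
  set A := g ⁻¹' Set.Iic r
  have hX' : Commute G (star X) := by
    simpa only [(hG.isSelfAdjoint h).star_eq] using hX.star_star
  have hlower : P Aᶜ * X * P A = 0 := hG.compl_mul_mul_eq_zero h hX r
  have hupper : P A * X * P Aᶜ = 0 := by
    have hstar := congrArg star (hG.compl_mul_mul_eq_zero h hX' r)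
    rwa [star_mul, star_mul, star_star, (h.isSelfAdjoint _ hA).star_eq,
      (h.isSelfAdjoint _ hA.compl).star_eq, star_zero, ← mul_assoc] at hstar
  calc P A * X = P A * X * (P A + P Aᶜ) := by rw [h.add_compl hA, mul_one]
    _ = (P A + P Aᶜ) * X * P A := by rw [mul_add, hupper, add_mul, add_mul, hlower]
    _ = X * P A := by rw [h.add_compl hA, one_mul]

theorem HasSpectralIntegral.measurable_commutingMeasurableSpace (h : IsIntertwiningMeasure P L)
    (hG : HasSpectralIntegral P L (fun x => (g x : ℍ)) G) (hX : Commute G X) :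
    Measurable[h.commutingMeasurableSpace X] g :=
  measurable_of_Iic (mδ := h.commutingMeasurableSpace X) fun r =>
    ⟨hG.measurable_of_real measurableSet_Iic, hG.commute_preimage_Iic h hX r⟩

end RealIntegrand

section ImaginaryUnit

variable {ι j : ℍ}

theorem re_eq_zero_of_mem_imaginaryUnits (hι : ι ∈ imaginaryUnits) : ι.re = 0 := by
  have hsq : ι * ι = -1 := hι
  have hnorm : Quaternion.normSq ι = 1 := by
    rw [← pow_eq_one_iff_of_nonneg Quaternion.normSq_nonneg two_ne_zero, sq, ← map_mul, hsq,
      Quaternion.normSq_neg, map_one]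
  rw [← Quaternion.sq_eq_neg_normSq, sq, hsq, hnorm, Quaternion.coe_one]

theorem star_eq_neg_of_mem_imaginaryUnits (hι : ι ∈ imaginaryUnits) : star ι = -ι :=
  Quaternion.star_eq_neg.2 (re_eq_zero_of_mem_imaginaryUnits hι)

theorem smul_mem_imaginaryUnits {r : ℍ} (hr : r.re = 0) (hr₀ : r ≠ 0) :
    ‖r‖⁻¹ • r ∈ imaginaryUnits := by
  have hsq : r * r = -((‖r‖ * ‖r‖ : ℝ) : ℍ) := by
    rw [← Quaternion.normSq_eq_norm_mul_self, ← sq, Quaternion.sq_eq_neg_normSq.2 hr]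
  have hnorm : ‖r‖ ≠ 0 := norm_ne_zero_iff.2 hr₀
  change (‖r‖⁻¹ • r) * (‖r‖⁻¹ • r) = -1
  rw [smul_mul_smul_comm, hsq, smul_neg, Quaternion.smul_coe, mul_mul_mul_comm,
    inv_mul_cancel₀ hnorm, one_mul, Quaternion.coe_one]

/-- A quaternion is imaginary and anticommutes with `ι` if it is orthogonal to `1` and `ι`. -/
theorem exists_anticommuting_imaginaryUnit (hι : ι ∈ imaginaryUnits) :
    ∃ j ∈ imaginaryUnits, ι * j = -(j * ι) := by
  have hspan : Submodule.span ℝ {1, ι} ≠ ⊤ := fun htop => by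
    classical
    have hle : Set.finrank ℝ (({1, ι} : Finset ℍ) : Set ℍ) ≤ 2 :=
      (finrank_span_finset_le_card _).trans Finset.card_le_two
    rw [Set.finrank, Finset.coe_pair, htop, finrank_top, Quaternion.finrank_eq_four] at hle
    omega
  obtain ⟨r, hr, hr₀⟩ := Submodule.exists_mem_ne_zero_of_ne_bot
    (mt Submodule.orthogonal_eq_bot_iff.1 hspan)
  have hmem (q : ℍ) (hq : q ∈ ({1, ι} : Set ℍ)) : (q * star r).re = 0 := by
    rw [← Quaternion.inner_def]
    exact (Submodule.mem_orthogonal _ r).1 hr q (Submodule.subset_span hq)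
  have hre : r.re = 0 := by
    simpa only [one_mul, Quaternion.re_star] using hmem 1 (Set.mem_insert 1 {ι})
  have hanti : ι * r = -(r * ι) := by
    have hstar := Quaternion.star_eq_neg.2 (hmem ι (Set.mem_insert_of_mem 1 rfl))
    rw [star_mul, star_star, star_eq_neg_of_mem_imaginaryUnits hι, Quaternion.star_eq_neg.2 hre]
      at hstar
    simpa only [mul_neg, neg_neg] using hstar.symm
  refine ⟨‖r‖⁻¹ • r, smul_mem_imaginaryUnits hre hr₀, ?_⟩
  rw [mul_smul_comm, smul_mul_assoc, hanti, smul_neg]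

theorem adjoin_pair_eq_top (hι : ι ∈ imaginaryUnits) (hj : j ∈ imaginaryUnits)
    (hij : ι * j = -(j * ι)) : Algebra.adjoin ℝ {ι, j} = ⊤ := by
  have hιsq : ι * ι = -1 := hι
  have hjsq : j * j = -1 := hj
  let B : QuaternionAlgebra.Basis ℍ (-1 : ℝ) 0 (-1) :=
    { i := ι, j := j, k := ι * j
      i_mul_i := by rw [hιsq, neg_smul, one_smul, zero_smul, add_zero]
      j_mul_j := by rw [hjsq, neg_smul, one_smul]
      i_mul_j := rfl
      j_mul_i := by rw [hij, zero_smul, zero_sub, neg_neg] }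
  let f : ℍ →ₐ[ℝ] ℍ := B.liftHom
  have hf : Function.Surjective f :=
    LinearMap.surjective_of_injective (f := f.toLinearMap) f.toRingHom.injective
  rw [eq_top_iff, ← f.range_eq_top.2 hf, show f.range = _ from B.range_liftHom,
    Algebra.adjoin_le_iff]
  have hιmem : ι ∈ Algebra.adjoin ℝ {ι, j} := Algebra.subset_adjoin (Set.mem_insert ι {j})
  have hjmem : j ∈ Algebra.adjoin ℝ {ι, j} := Algebra.subset_adjoin (Set.mem_insert_of_mem ι rfl)
  rintro q (rfl | rfl | rfl)
  exacts [hιmem, hjmem, mul_mem hιmem hjmem]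

theorem commute_of_commute_pair {A : Type*} [Ring A] [Algebra ℝ A] (hι : ι ∈ imaginaryUnits)
    (hj : j ∈ imaginaryUnits) (hij : ι * j = -(j * ι)) (L : ℍ →ₐ[ℝ] A) {X : A}
    (hιX : Commute (L ι) X) (hjX : Commute (L j) X) (q : ℍ) : Commute (L q) X := by
  have hq : q ∈ Algebra.adjoin ℝ {ι, j} := adjoin_pair_eq_top hι hj hij ▸ Algebra.mem_top
  induction hq using Algebra.adjoin_induction with
  | mem p hp => rcases hp with rfl | rfl <;> assumption
  | algebraMap r => rw [AlgHom.commutes]; exact Algebra.commutes r X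
  | add p q _ _ hp hq => rw [map_add]; exact hp.add_left hq
  | mul p q _ _ hp hq => rw [map_mul]; exact hp.mul_left hq

/-- The imaginary part `β` of `α + ιβ`, extended linearly to all of `ℍ`. -/
noncomputable def imPart (ι q : ℍ) : ℝ := -(ι * q).re

theorem re_coe_add_mul_coe (hι : ι ∈ imaginaryUnits) (α β : ℝ) :
    ((α : ℍ) + ι * (β : ℍ)).re = α := by
  rw [Quaternion.re_add, Quaternion.mul_coe_eq_smul]
  simp [re_eq_zero_of_mem_imaginaryUnits hι]

theorem imPart_coe_add_mul_coe (hι : ι ∈ imaginaryUnits) (α β : ℝ) :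
    imPart ι ((α : ℍ) + ι * (β : ℍ)) = β := by
  have hsq : ι * ι = -1 := hι
  rw [imPart, mul_add, ← mul_assoc, hsq, Quaternion.re_add, Quaternion.mul_coe_eq_smul]
  simp [re_eq_zero_of_mem_imaginaryUnits hι]

theorem imPart_nonneg (hι : ι ∈ imaginaryUnits) {q : ℍ} (hq : q ∈ halfPlane ι) :
    0 ≤ imPart ι q := by
  obtain ⟨α, β, hβ, rfl⟩ := hq
  rwa [imPart_coe_add_mul_coe hι]

theorem re_add_mul_imPart (hι : ι ∈ imaginaryUnits) {q : ℍ} (hq : q ∈ halfPlane ι) :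
    (q.re : ℍ) + ι * (imPart ι q : ℍ) = q := by
  obtain ⟨α, β, -, rfl⟩ := hq
  rw [re_coe_add_mul_coe hι, imPart_coe_add_mul_coe hι]

theorem commute_of_mem_halfPlane {q : ℍ} (hq : q ∈ halfPlane ι) : Commute ι q := by
  obtain ⟨α, β, -, rfl⟩ := hq
  exact (Quaternion.coe_commute α ι).symm.add_right
    ((Commute.refl ι).mul_right (Quaternion.coe_commute β ι).symm)

theorem mul_eq_star_mul_of_mem_halfPlane (hι : ι ∈ imaginaryUnits) (hij : ι * j = -(j * ι)) {q : ℍ}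
    (hq : q ∈ halfPlane ι) : j * q = star q * j := by
  obtain ⟨α, β, -, rfl⟩ := hq
  rw [star_add, star_mul, Quaternion.star_coe, Quaternion.star_coe,
    star_eq_neg_of_mem_imaginaryUnits hι, mul_add, add_mul, Quaternion.coe_commutes α j,
    mul_assoc (β : ℍ), neg_mul, hij, neg_neg, Quaternion.coe_commutes β, mul_assoc]

theorem neg_mul_sub_star_of_mem_halfPlane (hι : ι ∈ imaginaryUnits) {q : ℍ}
    (hq : q ∈ halfPlane ι) : -ι * (q - star q) = ((2 * imPart ι q : ℝ) : ℍ) := by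
  have hsq : ι * ι = -1 := hι
  obtain ⟨α, β, -, rfl⟩ := hq
  rw [imPart_coe_add_mul_coe hι, star_add, star_mul, Quaternion.star_coe, Quaternion.star_coe,
    star_eq_neg_of_mem_imaginaryUnits hι, mul_neg, Quaternion.coe_commutes,
    add_sub_add_left_eq_sub, sub_neg_eq_add, mul_add, ← mul_assoc, neg_mul, hsq, neg_neg, one_mul,
    two_mul, Quaternion.coe_add]

end ImaginaryUnit

section HalfPlane

variable {E : Type*} [NormedAddCommGroup E] [InnerProductSpace ℝ E] [CompleteSpace E]
  {Ω : Type*} [MeasurableSpace Ω] {P : Set Ω → E →L[ℝ] E} {L : ℍ →⋆ₐ[ℝ] (E →L[ℝ] E)}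
  {ι j : ℍ} {φ : Ω → ℍ} {T X : E →L[ℝ] E}

theorem star_map_of_mem_imaginaryUnits (hι : ι ∈ imaginaryUnits) : star (L ι) = -L ι := by
  rw [← map_star, star_eq_neg_of_mem_imaginaryUnits hι, map_neg]

theorem map_mul_self_of_mem_imaginaryUnits (hι : ι ∈ imaginaryUnits) : L ι * L ι = -1 := by
  rw [← map_mul, show ι * ι = -1 from hι, map_neg, map_one]

theorem commute_star_of_commute_imaginaryUnit (hι : ι ∈ imaginaryUnits) (h : Commute (L ι) T) :
    Commute (L ι) (star T) := by
  simpa only [star_map_of_mem_imaginaryUnits hι, Commute.neg_left_iff] using h.star_star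

theorem mul_star_eq_of_mul_eq_star_mul (hj : j ∈ imaginaryUnits) (h : L j * T = star T * L j) :
    L j * star T = T * L j := by
  have hjsq : L j * L j = -1 := map_mul_self_of_mem_imaginaryUnits hj
  have hconj : L j * (L j * T) * L j = L j * (star T * L j) * L j := by rw [h]
  rw [← mul_assoc, hjsq, ← mul_assoc, mul_assoc _ (L j) (L j), hjsq, mul_assoc] at hconj
  simpa only [neg_mul, one_mul, mul_neg, mul_one, neg_inj] using hconj.symm

theorem commute_add_star (hj : j ∈ imaginaryUnits) (h : L j * T = star T * L j) :
    Commute (L j) (T + star T) := by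
  rw [Commute, SemiconjBy, mul_add, add_mul, h, mul_star_eq_of_mul_eq_star_mul hj h, add_comm]

theorem commute_sub_star_mul_self (hj : j ∈ imaginaryUnits) (h : L j * T = star T * L j) :
    Commute (L j) ((T - star T) * (T - star T)) := by
  have hanti : L j * (T - star T) = -(T - star T) * L j := by
    rw [mul_sub, h, mul_star_eq_of_mul_eq_star_mul hj h, neg_sub, sub_mul]
  rw [Commute, SemiconjBy, ← mul_assoc, hanti, mul_assoc, hanti, ← mul_assoc, neg_mul_neg]

theorem neg_mul_sub_star_mul_self (hι : ι ∈ imaginaryUnits) (h : Commute (L ι) T) :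
    -(L ι * (T - star T)) * -(L ι * (T - star T)) = -((T - star T) * (T - star T)) := by
  have hcomm : Commute (L ι) (T - star T) :=
    h.sub_right (commute_star_of_commute_imaginaryUnit hι h)
  rw [neg_mul_neg, mul_assoc, ← mul_assoc (T - star T), ← hcomm.eq, mul_assoc, ← mul_assoc,
    map_mul_self_of_mem_imaginaryUnits hι, neg_one_mul]

namespace HasSpectralIntegral

theorem two_mul_re (h : IsIntertwiningMeasure P L) (hT : HasSpectralIntegral P L φ T) :
    HasSpectralIntegral P L (fun x => ((2 * (φ x).re : ℝ) : ℍ)) (T + star T) := by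
  simpa only [Quaternion.self_add_star', Quaternion.coe_mul] using hT.add h.1 (hT.star h)

theorem two_mul_imPart (h : IsIntertwiningMeasure P L) (hT : HasSpectralIntegral P L φ T)
    (hι : ι ∈ imaginaryUnits) (hφ : ∀ x, φ x ∈ halfPlane ι) :
    HasSpectralIntegral P L (fun x => ((2 * imPart ι (φ x) : ℝ) : ℍ))
      (-(L ι * (T - star T))) := by
  simpa only [map_neg, neg_mul (L ι), neg_mul_sub_star_of_mem_halfPlane hι (hφ _)] using
    (hT.sub h (hT.star h)).const_mul h (-ι)

theorem commute_of_halfPlane (h : IsIntertwiningMeasure P L) (hT : HasSpectralIntegral P L φ T)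
    (hφ : ∀ x, φ x ∈ halfPlane ι) : Commute (L ι) T :=
  HasSpectralIntegral.unique h (hT.const_mul h ι)
    (by simpa only [(commute_of_mem_halfPlane (hφ _)).eq] using hT.mul_const h ι)

theorem mul_eq_star_mul_of_halfPlane (h : IsIntertwiningMeasure P L)
    (hT : HasSpectralIntegral P L φ T) (hι : ι ∈ imaginaryUnits) (hφ : ∀ x, φ x ∈ halfPlane ι)
    (hij : ι * j = -(j * ι)) : L j * T = star T * L j :=
  HasSpectralIntegral.unique h (hT.const_mul h j)
    (by simpa only [mul_eq_star_mul_of_mem_halfPlane hι hij (hφ _)] using (hT.star h).mul_const h j)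

theorem isPositive_of_halfPlane (h : IsIntertwiningMeasure P L) (hT : HasSpectralIntegral P L φ T)
    (hι : ι ∈ imaginaryUnits) (hφ : ∀ x, φ x ∈ halfPlane ι) :
    (-(L ι * (T - star T))).IsPositive :=
  (hT.two_mul_imPart h hι hφ).isPositive h fun x =>
    mul_nonneg zero_le_two (imPart_nonneg hι (hφ x))

/-- The values of `φ` are recovered from its real part and from the square of its imaginary part,
whose integrals commute with `X`. -/
theorem commute_preimage (h : IsIntertwiningMeasure P L) (hT : HasSpectralIntegral P L φ T)
    (hι : ι ∈ imaginaryUnits) (hφ : ∀ x, φ x ∈ halfPlane ι) (hre : Commute X (T + star T))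
    (him : Commute X ((T - star T) * (T - star T))) [MeasurableSpace ℍ] [BorelSpace ℍ]
    {B : Set ℍ} (hB : MeasurableSet B) : Commute (P (φ ⁻¹' B)) X := by
  have hReal := (hT.two_mul_re h).measurable_commutingMeasurableSpace h hre.symm
  have hImSq : HasSpectralIntegral P L
      (fun x => ((2 * imPart ι (φ x) * (2 * imPart ι (φ x)) : ℝ) : ℍ))
      (-((T - star T) * (T - star T))) := by
    have hS := hT.two_mul_imPart h hι hφ
    rw [← neg_mul_sub_star_mul_self hι (hT.commute_of_halfPlane h hφ)]
    simpa only [Quaternion.coe_mul] using hS.mul h hS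
  have hImag := hImSq.measurable_commutingMeasurableSpace h him.symm.neg_left
  have hrec : Continuous fun p : ℝ × ℝ => ((p.1 / 2 : ℝ) : ℍ) + ι * ((√p.2 / 2 : ℝ) : ℍ) :=
    (Quaternion.continuous_coe.comp (by fun_prop)).add
      (continuous_const.mul (Quaternion.continuous_coe.comp (by fun_prop)))
  have hφ_eq : φ = (fun p : ℝ × ℝ => ((p.1 / 2 : ℝ) : ℍ) + ι * ((√p.2 / 2 : ℝ) : ℍ)) ∘
      fun x => (2 * (φ x).re, 2 * imPart ι (φ x) * (2 * imPart ι (φ x))) := by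
    ext1 x
    rw [Function.comp_apply, Real.sqrt_mul_self (mul_nonneg zero_le_two (imPart_nonneg hι (hφ x))),
      mul_div_cancel_left₀ _ two_ne_zero, mul_div_cancel_left₀ _ two_ne_zero,
      re_add_mul_imPart hι (hφ x)]
  have hmeas : Measurable[h.commutingMeasurableSpace X] φ := by
    rw [hφ_eq]
    exact hrec.measurable.comp (hReal.prodMk hImag)
  exact (hmeas hB).2

theorem commute_preimage_of_commute (h : IsIntertwiningMeasure P L)
    (hT : HasSpectralIntegral P L φ T) (hι : ι ∈ imaginaryUnits) (hφ : ∀ x, φ x ∈ halfPlane ι)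
    {L' : ℍ →⋆ₐ[ℝ] (E →L[ℝ] E)} (hιT : Commute (L' ι) T) (hj : j ∈ imaginaryUnits)
    (hij : ι * j = -(j * ι)) (hjT : L' j * T = star T * L' j) [MeasurableSpace ℍ] [BorelSpace ℍ]
    {B : Set ℍ} (hB : MeasurableSet B) (q : ℍ) : Commute (L' q) (P (φ ⁻¹' B)) := by
  have hιT' := commute_star_of_commute_imaginaryUnit hι hιT
  refine commute_of_commute_pair hι hj hij L'.toAlgHom ?_ ?_ q
  · exact (hT.commute_preimage h hι hφ (hιT.add_right hιT')
      ((hιT.sub_right hιT').mul_right (hιT.sub_right hιT')) hB).symm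
  · exact (hT.commute_preimage h hι hφ (commute_add_star hj hjT)
      (commute_sub_star_mul_self hj hjT) hB).symm

/-- `-L ι * (T - T*)` and `-L' ι * (T - T*)` are commuting positive square roots of
`-(T - T*)²`. -/
theorem mul_sub_star_eq_of_isPositive (h : IsIntertwiningMeasure P L)
    (hT : HasSpectralIntegral P L φ T) (hι : ι ∈ imaginaryUnits) (hφ : ∀ x, φ x ∈ halfPlane ι)
    {L' : ℍ →⋆ₐ[ℝ] (E →L[ℝ] E)} (h' : IsIntertwiningMeasure P L') (hιT : Commute (L' ι) T)
    (hpos : (-(L' ι * (T - star T))).IsPositive) :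
    -(L ι * (T - star T)) = -(L' ι * (T - star T)) := by
  have hιT₀ : Commute (L ι) T := hT.commute_of_halfPlane h hφ
  have hS := hT.two_mul_imPart h hι hφ
  have hD : Commute (-(L ι * (T - star T))) (T - star T) :=
    ((hιT₀.sub_right (commute_star_of_commute_imaginaryUnit hι hιT₀)).mul_left
      (Commute.refl _)).neg_left
  refine eq_of_isPositive_of_sq_eq (hT.isPositive_of_halfPlane h hι hφ) hpos ?_ ?_
  · exact (((hS.congr_left h).commute_left h' ι).symm.mul_right hD).neg_right
  · rw [neg_mul_sub_star_mul_self hι hιT₀, neg_mul_sub_star_mul_self hι hιT]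

theorem congr_left_of_isPositive (h : IsIntertwiningMeasure P L)
    (hT : HasSpectralIntegral P L φ T) (hι : ι ∈ imaginaryUnits) (hφ : ∀ x, φ x ∈ halfPlane ι)
    {L' : ℍ →⋆ₐ[ℝ] (E →L[ℝ] E)} (h' : IsIntertwiningMeasure P L') (hιT : Commute (L' ι) T)
    (hpos : (-(L' ι * (T - star T))).IsPositive) : HasSpectralIntegral P L' φ T := by
  have hre : HasSpectralIntegral P L' _ (T + star T) := (hT.two_mul_re h).congr_left h
  have him : HasSpectralIntegral P L' _ (-(L ι * (T - star T))) :=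
    (hT.two_mul_imPart h hι hφ).congr_left h
  rw [hT.mul_sub_star_eq_of_isPositive h hι hφ h' hιT hpos] at him
  convert (hre.add h'.1 (him.const_mul h' ι)).const_mul h' ((1 / 2 : ℝ) : ℍ) using 1
  · ext1 x
    rw [Quaternion.coe_mul, Quaternion.coe_mul, ← mul_assoc ι, ← Quaternion.coe_commutes 2 ι,
      mul_assoc, ← mul_add, re_add_mul_imPart hι (hφ x), ← mul_assoc, ← Quaternion.coe_mul,
      one_div_mul_cancel two_ne_zero, Quaternion.coe_one, one_mul]
  · rw [mul_neg, ← mul_assoc, map_mul_self_of_mem_imaginaryUnits hι, neg_one_mul, neg_neg,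
      add_add_sub_cancel, ← two_smul ℝ T, show L' ((1 / 2 : ℝ) : ℍ) = algebraMap ℝ _ (1 / 2) from
        AlgHomClass.commutes L' _, ← Algebra.smul_def, smul_smul, one_div_mul_cancel two_ne_zero,
      one_smul]

end HasSpectralIntegral

end HalfPlane

section Transport

attribute [local instance] realInnerProductSpace

variable {H : Type*} [NormedAddCommGroup H] [QuaternionicHilbertSpace H]

theorem real_inner_eq_re (u v : H) : inner ℝ u v = (inner ℍ u v).re := rfl

theorem norm_qinner_le (u v : H) : ‖inner ℍ u v‖ ≤ ‖u‖ * ‖v‖ := by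
  have h := real_inner_le_norm u (v <• star (inner ℍ u v))
  rw [real_inner_eq_re, qinner_smul_right, Quaternion.self_mul_star, Quaternion.re_coe,
    norm_smul_right, norm_star, Quaternion.normSq_eq_norm_mul_self] at h
  rcases (norm_nonneg (inner ℍ u v)).eq_or_lt with h₀ | h₀
  · rw [← h₀]
    positivity
  · exact le_of_mul_le_mul_left (by linarith) h₀

/-- The continuous right linear functional `⟨u|·⟩`. -/
noncomputable def qinnerRight (u : H) : H →L[ℍᵐᵒᵖ] ℍ where
  toFun v := inner ℍ u v
  map_add' := qinner_add_right u
  map_smul' q v := qinner_smul_right u v q.unop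
  cont := AddMonoidHomClass.continuous_of_bound
    (AddMonoidHom.mk' (fun v => inner ℍ u v) (qinner_add_right u)) ‖u‖ (norm_qinner_le u)

theorem qinnerRight_apply (u v : H) : qinnerRight u v = inner ℍ u v := rfl

theorem inner_adjoint_right (T : BoundedOp H) (u v : H) :
    inner ℍ u (adjoint T v) = inner ℍ (T u) v := by
  rw [← qinner_conj_symm u, adjoint_inner_left, qinner_conj_symm]

/-- A quaternionic operator as an operator on the underlying real Hilbert space. -/
noncomputable def toReal : BoundedOp H →+* (H →L[ℝ] H) where
  toFun T :=
    { toFun := T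
      map_add' := map_add T
      map_smul' := fun _ x => T.map_smul _ x
      cont := T.continuous }
  map_one' := rfl
  map_mul' _ _ := rfl
  map_zero' := rfl
  map_add' _ _ := rfl

theorem toReal_apply (T : BoundedOp H) (u : H) : toReal T u = T u := rfl

theorem toReal_injective : Function.Injective (toReal (H := H)) := fun _ _ h =>
  ContinuousLinearMap.ext fun u => DFunLike.congr_fun h u

theorem toReal_adjoint (T : BoundedOp H) : toReal (adjoint T) = star (toReal T) := by
  rw [ContinuousLinearMap.star_eq_adjoint, ContinuousLinearMap.eq_adjoint_iff]
  intro u v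
  rw [real_inner_eq_re, real_inner_eq_re, toReal_apply, toReal_apply, adjoint_inner_left]

theorem tendstoInOpNorm_iff {S : ℕ → BoundedOp H} {T : BoundedOp H} :
    TendstoInOpNorm S T ↔ Tendsto (fun n => toReal (S n)) atTop (𝓝 (toReal T)) := by
  have hbound {n : ℕ} {ε : ℝ} (hε : 0 ≤ ε) :
      (∀ u, ‖S n u - T u‖ ≤ ε * ‖u‖) ↔ dist (toReal (S n)) (toReal T) ≤ ε := by
    rw [dist_eq_norm, ContinuousLinearMap.opNorm_le_iff hε]
    rfl
  rw [Metric.nhds_basis_closedBall.tendsto_right_iff]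
  simp only [eventually_atTop, Metric.mem_closedBall]
  exact forall₂_congr fun ε hε => exists_congr fun _ => forall₂_congr fun _ _ => hbound hε.le

section Positive

theorem eq_zero_of_forall_star_mul_eq {x : ℍ} (h : ∀ q, star (x * q) = x * q) : x = 0 := by
  have hx : x = x.re := Quaternion.star_eq_self.1 (by simpa only [mul_one] using h 1)
  obtain ⟨i, hi⟩ : ∃ i : ℍ, i.imI = 1 := ⟨⟨0, 1, 0, 0⟩, rfl⟩
  have hxi := congrArg (·.imI) (h i)
  rw [hx, Quaternion.coe_mul_eq_smul] at hxi
  have hre : x.re = 0 := by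
    simpa only [star_smul, Quaternion.imI_smul, Quaternion.imI_star, hi, star_trivial, smul_eq_mul,
      mul_neg, mul_one, neg_eq_self] using hxi
  rw [hx, hre, Quaternion.coe_zero]

/-- If the quadratic form of `D` vanishes, the form `⟨u|Dv⟩` is antisymmetric; for a skew-adjoint
`D` it is therefore real-valued, hence zero by quaternionic linearity. -/
theorem eq_zero_of_forall_inner_self_eq_zero {D : BoundedOp H} (hD : adjoint D = -D)
    (h : ∀ u, inner ℍ u (D u) = 0) : D = 0 := by
  have hanti (u v : H) : inner ℍ u (D v) = -inner ℍ v (D u) := by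
    have huv := h (u + v)
    rw [map_add, qinner_add_right, qinner_add_left, qinner_add_left, h u, h v, zero_add,
      add_zero] at huv
    exact eq_neg_of_add_eq_zero_right huv
  have hreal (u v : H) : star (inner ℍ u (D v)) = inner ℍ u (D v) := by
    rw [qinner_conj_symm, ← inner_adjoint_right, hD, hanti u v]
    exact map_neg (qinnerRight v) (D u)
  refine ContinuousLinearMap.ext fun v => norm_eq_zero.1 ?_
  have hzero : inner ℍ (D v) (D v) = 0 := eq_zero_of_forall_star_mul_eq fun q => by
    rw [← qinner_smul_right, ← map_smul, hreal]
  rwa [qinner_self, ← Quaternion.coe_zero, Quaternion.coe_inj, sq_eq_zero_iff] at hzero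

theorem IsPositive.adjoint_eq {T : BoundedOp H} (hT : IsPositive T) : adjoint T = T := by
  refine sub_eq_zero.1 (eq_zero_of_forall_inner_self_eq_zero (toReal_injective ?_) fun u => ?_)
  · rw [toReal_adjoint, map_neg, map_sub, toReal_adjoint, star_sub, star_star, neg_sub]
  · obtain ⟨r, -, hr⟩ := hT u
    rw [sub_apply, ← qinnerRight_apply, map_sub, qinnerRight_apply, qinnerRight_apply,
      inner_adjoint_right, ← qinner_conj_symm, hr, Quaternion.star_coe, sub_self]

theorem isPositive_toReal_iff {T : BoundedOp H} : (toReal T).IsPositive ↔ IsPositive T := by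
  constructor
  · intro h u
    have hT : adjoint T = T := toReal_injective (by rw [toReal_adjoint, h.isSelfAdjoint.star_eq])
    refine ⟨(inner ℍ u (T u)).re, h.inner_nonneg_right u, Quaternion.star_eq_self.1 ?_⟩
    rw [qinner_conj_symm, ← adjoint_inner_left, hT]
  · intro h
    refine ContinuousLinearMap.isPositive_def'.2 ⟨?_, fun u => ?_⟩
    · rw [IsSelfAdjoint, ← toReal_adjoint, h.adjoint_eq]
    · obtain ⟨r, hr, hu⟩ := h u
      rw [ContinuousLinearMap.reApplyInnerSelf_apply, real_inner_comm, real_inner_eq_re,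
        toReal_apply, hu]
      exact hr

end Positive

section LeftScalarMul

variable {N : Set H} {L : ℍ → BoundedOp H}

theorem IsHilbertBasis.ext (hN : IsHilbertBasis N) {u v : H}
    (h : ∀ z ∈ N, inner ℍ z u = inner ℍ z v) : u = v := by
  refine sub_eq_zero.1 (hN.perp_eq_zero _ fun z hz => ?_)
  rw [← qinner_conj_symm, ← qinnerRight_apply, map_sub, qinnerRight_apply, qinnerRight_apply,
    h z hz, sub_self, star_zero]

namespace IsLeftScalarMul

theorem exists_inner_eq (hL : IsLeftScalarMul L) :
    ∃ N, IsHilbertBasis N ∧ ∀ z ∈ N, ∀ q u, inner ℍ z (L q u) = q * inner ℍ z u := by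
  obtain ⟨N, hN, hsum⟩ := hL
  refine ⟨N, hN, fun z hz q u => ?_⟩
  have hcoord := (qinnerRight z).hasSum (hsum q u)
  refine (hcoord.unique (hasSum_single ⟨z, hz⟩ fun w hw => ?_)).trans ?_
  · rw [qinnerRight_apply, qinner_smul_right, qinner_smul_right,
      hN.orthogonal z hz w w.2 fun h => hw (Subtype.ext h.symm), zero_mul, zero_mul]
  · rw [qinnerRight_apply, qinner_smul_right, qinner_smul_right,
      qinner_self, hN.norm_eq_one z hz, one_pow, Quaternion.coe_one, one_mul]

theorem map_coe (hL : IsLeftScalarMul L) (r : ℝ) :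
    toReal (L r) = algebraMap ℝ (H →L[ℝ] H) r := by
  obtain ⟨N, hN, hcoord⟩ := hL.exists_inner_eq
  ext u
  rw [toReal_apply, Algebra.algebraMap_eq_smul_one]
  change L r u = u <• (r : ℍ)
  refine hN.ext fun z hz => ?_
  rw [hcoord z hz, qinner_smul_right, Quaternion.coe_commutes]

theorem map_mul (hL : IsLeftScalarMul L) (p q : ℍ) : L (p * q) = L p * L q := by
  obtain ⟨N, hN, hcoord⟩ := hL.exists_inner_eq
  refine ContinuousLinearMap.ext fun u => hN.ext fun z hz => ?_
  rw [mul_apply_eq_comp, hcoord z hz, hcoord z hz, hcoord z hz, mul_assoc]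

theorem map_add (hL : IsLeftScalarMul L) (p q : ℍ) : L (p + q) = L p + L q := by
  obtain ⟨N, hN, hcoord⟩ := hL.exists_inner_eq
  refine ContinuousLinearMap.ext fun u => hN.ext fun z hz => ?_
  rw [add_apply, qinner_add_right, hcoord z hz, hcoord z hz, hcoord z hz, add_mul]

theorem map_star (hL : IsLeftScalarMul L) (q : ℍ) : L (star q) = adjoint (L q) := by
  obtain ⟨N, hN, hcoord⟩ := hL.exists_inner_eq
  have hbasis (z : H) (hz : z ∈ N) : L q z = z <• q := by
    refine hN.ext fun w hw => ?_
    rw [hcoord w hw, qinner_smul_right]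
    rcases eq_or_ne w z with rfl | hwz
    · rw [qinner_self, Quaternion.coe_commutes]
    · rw [hN.orthogonal w hw z hz hwz, zero_mul, mul_zero]
  refine ContinuousLinearMap.ext fun u => hN.ext fun z hz => ?_
  rw [hcoord z hz, inner_adjoint_right, hbasis z hz, qinner_smul_left]

/-- A left scalar multiplication as a `*`-representation of `ℍ` on the underlying real Hilbert
space. -/
noncomputable def starAlgHom (hL : IsLeftScalarMul L) : ℍ →⋆ₐ[ℝ] (H →L[ℝ] H) where
  toFun q := toReal (L q)
  map_one' := by simpa only [Quaternion.coe_one, _root_.map_one] using hL.map_coe 1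
  map_mul' p q := by rw [hL.map_mul, _root_.map_mul]
  map_zero' := by simpa only [Quaternion.coe_zero, _root_.map_zero] using hL.map_coe 0
  map_add' p q := by rw [hL.map_add, _root_.map_add]
  commutes' := hL.map_coe
  map_star' q := by rw [hL.map_star, toReal_adjoint]

theorem starAlgHom_apply (hL : IsLeftScalarMul L) (q : ℍ) : hL.starAlgHom q = toReal (L q) := rfl

theorem commute_starAlgHom_iff (hL : IsLeftScalarMul L) {q : ℍ} {T : BoundedOp H} :
    Commute (hL.starAlgHom q) (toReal T) ↔ L q * T = T * L q := by
  rw [Commute, SemiconjBy, starAlgHom_apply, ← _root_.map_mul, ← _root_.map_mul,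
    toReal_injective.eq_iff]

theorem starAlgHom_mul_eq_star_mul_iff (hL : IsLeftScalarMul L) {q : ℍ} {T : BoundedOp H} :
    hL.starAlgHom q * toReal T = star (toReal T) * hL.starAlgHom q ↔
      L q * T = adjoint T * L q := by
  rw [starAlgHom_apply, ← toReal_adjoint, ← _root_.map_mul, ← _root_.map_mul,
    toReal_injective.eq_iff]

theorem isPositive_neg_starAlgHom_mul_sub_star_iff (hL : IsLeftScalarMul L) {q : ℍ}
    {T : BoundedOp H} :
    (-(hL.starAlgHom q * (toReal T - star (toReal T)))).IsPositive ↔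
      IsPositive (-(L q * (T - adjoint T))) := by
  rw [starAlgHom_apply, ← toReal_adjoint, ← map_sub, ← _root_.map_mul, ← map_neg,
    isPositive_toReal_iff]

end IsLeftScalarMul

end LeftScalarMul

section PVM

variable {ι : ℍ} {P : Set (halfPlane ι) → BoundedOp H} {L : ℍ → BoundedOp H} {T : BoundedOp H}

theorem measurableSet_pvmSupport : MeasurableSet (pvmSupport P) :=
  (isOpen_sUnion fun _ hO => hO.1).measurableSet.compl

theorem indicator_coe_mem_halfPlane (A : Set (halfPlane ι)) (z : halfPlane ι) :
    A.indicator (fun z => (z : ℍ)) z ∈ halfPlane ι := by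
  by_cases hz : z ∈ A
  · rw [Set.indicator_of_mem hz]
    exact z.2
  · rw [Set.indicator_of_notMem hz]
    exact ⟨0, 0, le_rfl, by simp⟩

namespace IsQPVM

theorem isProjectionValuedMeasure (hP : IsQPVM P) :
    IsProjectionValuedMeasure fun A => toReal (P A) where
  univ := by rw [hP.univ, map_one]
  inter A B hA hB := by rw [← map_mul, hP.inter A B hA hB]
  isSelfAdjoint A hA := (isPositive_toReal_iff.2 (hP.positive A hA)).isSelfAdjoint
  hasSum_iUnion A hA hd u := by
    have h := hP.sigma_additive Set.univ (fun n => A n) (fun n => hA n)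
      (fun n m hnm => hd (Subtype.coe_injective.ne hnm)) u
    rw [Set.iUnion_coe_set, Set.biUnion_univ] at h
    exact (Equiv.hasSum_iff (Equiv.Set.univ ℕ)).1 h

theorem toReal_compl_pvmSupport (hP : IsQPVM P) : toReal (P (pvmSupport P)ᶜ) = 0 := by
  have : SecondCountableTopology ℍ := secondCountable_of_proper
  simpa only [map_eq_zero_iff _ (toReal_injective (H := H)), pvmSupport, compl_compl] using
    hP.isProjectionValuedMeasure.sUnion_isOpen_eq_zero

theorem isIQPVM_iff (hP : IsQPVM P) (hL : IsLeftScalarMul L) :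
    IsIQPVM P L ↔ IsIntertwiningMeasure (fun A => toReal (P A)) hL.starAlgHom :=
  ⟨fun h => ⟨hP.isProjectionValuedMeasure, fun A hA q =>
      hL.commute_starAlgHom_iff.2 (h.commute A q hA).symm⟩,
    fun h => ⟨hP, hL, fun A q hA => (hL.commute_starAlgHom_iff.1 (h.commute A hA q)).symm⟩⟩

theorem isIntertwiningMeasure_of_commute (hP : IsQPVM P) {𝓛 : ℍ →⋆ₐ[ℝ] (H →L[ℝ] H)}
    [MeasurableSpace ℍ] [BorelSpace ℍ]
    (h : ∀ B, MeasurableSet B → ∀ q,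
      Commute (𝓛 q) (toReal (P ((pvmSupport P).indicator (fun z => (z : ℍ)) ⁻¹' B)))) :
    IsIntertwiningMeasure (fun A => toReal (P A)) 𝓛 := by
  refine ⟨hP.isProjectionValuedMeasure, fun A hA q => ?_⟩
  have hcomap : halfPlane.measurableSpace ι = .comap Subtype.val ‹MeasurableSpace ℍ› := by
    rw [BorelSpace.measurable_eq (α := ℍ)]
    exact borel_comap
  obtain ⟨B, hB, rfl⟩ : MeasurableSet[.comap Subtype.val _] A := hcomap ▸ hA
  rw [← hP.isProjectionValuedMeasure.preimage_indicator continuous_subtype_val.measurable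
    measurableSet_pvmSupport hP.toReal_compl_pvmSupport hB]
  exact h B hB q

end IsQPVM

theorem hasIntegral_iff (hL : IsLeftScalarMul L) {φ : halfPlane ι → ℍ} :
    HasIntegral P L φ T ↔ HasSpectralIntegral (fun A => toReal (P A)) hL.starAlgHom
      ((pvmSupport P).indicator φ) (toReal T) := by
  simp only [HasIntegral, HasSpectralIntegral, tendstoInOpNorm_iff, simpleIntegral, map_sum,
    map_mul, simpleSpectralIntegral_eq_sum, hL.starAlgHom_apply]

end PVM

end Transport

end QuaternionicSpectral

theorem mainTheorem2 {H : Type*} [NormedAddCommGroup H] [QuaternionicHilbertSpace H] [Nontrivial H]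
    (ι : ℍ) (hι : ι ∈ imaginaryUnits)
    (T : BoundedOp H) (hT : IsNormal T)
    (P : Set (halfPlane ι) → BoundedOp H) (hP : IsAssociatedQPVM P T)
    (L : ℍ → BoundedOp H) (hL : IsLeftScalarMul L) :
    (IsIQPVM P L ∧ HasIntegral P L (fun z => (z : ℍ)) T) ↔
      (L ι * T = T * L ι ∧
        (∃ j ∈ imaginaryUnits, ι * j = -(j * ι) ∧ L j * T = adjoint T * L j) ∧
        IsPositive (-(L ι * (T - adjoint T)))) := by
  let _ := realInnerProductSpace H
  obtain ⟨-, L₀, hPL₀, hT₀⟩ := hP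
  have hP := hPL₀.isQPVM
  have hL₀ := hPL₀.isLeftScalarMul
  have h₀ := (hP.isIQPVM_iff hL₀).1 hPL₀
  have hid := indicator_coe_mem_halfPlane (pvmSupport P)
  rw [hasIntegral_iff hL₀] at hT₀
  rw [hP.isIQPVM_iff hL, hasIntegral_iff hL, ← hL.commute_starAlgHom_iff,
    ← hL.isPositive_neg_starAlgHom_mul_sub_star_iff]
  simp only [← hL.starAlgHom_mul_eq_star_mul_iff]
  constructor
  · rintro ⟨h, hT⟩
    obtain ⟨j, hj, hij⟩ := exists_anticommuting_imaginaryUnit hι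
    exact ⟨hT.commute_of_halfPlane h hid,
      ⟨j, hj, hij, hT.mul_eq_star_mul_of_halfPlane h hι hid hij⟩,
      hT.isPositive_of_halfPlane h hι hid⟩
  · rintro ⟨hιT, ⟨j, hj, hij, hjT⟩, hpos⟩
    borelize ℍ
    have h := hP.isIntertwiningMeasure_of_commute fun _ =>
      hT₀.commute_preimage_of_commute h₀ hι hid hιT hj hij hjT
    exact ⟨h, hT₀.congr_left_of_isPositive h₀ hι hid h hιT hpos⟩
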